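/- Let $\mathcal H$ be a separable complex Hilbert space, $\mathcal M\subset\mathcal B(\mathcal H)$ a von Neumann algebra and $\rho$ a faithful normal semifinite trace on $\mathcal M$. Let $\mathrm{Proj}(\mathcal M)$ be the set of selfadjoint projections of $\mathcal M$, $\mathcal P=\{P\in\mathrm{Proj}(\mathcal M):\rho(P)<\infty\}$, $\mathcal R=\{x\in\mathcal M: xP=x\text{ for some }P\in\mathcal P\}$ and $\mathcal R_1^+=\{a\in\mathcal R:0\le a\le I\}$. For $x\in\mathcal M$ put $|x|_1=\rho((x^*x)^{1/2})$, $L^1(\mathcal M,\rho)\cap\mathcal M=\{x\in\mathcal M:|x|_1<\infty\}$ and $\mu(t,x)=\inf\{\|x(I-P)\|:P\in\mathcal P,\ \rho(P)\le t\}$ for $t>0$. Let $|\cdot|_{\mathcal J}$ be a norm on $L^1(\mathcal M,\rho)\cap\mathcal M$ such that 1. if $\mu(t,x)\le\mu(t,y)$ for all $t>0$, then $|x|_{\mathcal J}\le|y|_{\mathcal J}$; 2. there are constants $C_1,C_2\in(0,\infty)$ with $C_1\min(|x|_1,\|x\|)\le|x|_{\mathcal J}\le C_2(|x|_1+\|x\|)$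 for all $x \in L^1(\mathcal M,\rho)\cap\mathcal M$; 3. if $P_m\in\mathcal P$ and $\rho(P_m)\to0$, then $|P_m|_{\mathcal J}\to0$. Let $\tau=(T_j)_{1\le j\le n}$ be an $n$-tuple of elements of $\mathcal M$, and let $\alpha=(\alpha_j)_{1\le j\le n}$ be an $n$-tuple of $*$-automorphisms of $\mathcal M$ which preserve $\rho$. For $P\in\mathrm{Proj}(\mathcal M)$ define $k_{\mathcal J}(\tau;P)$ and $k_{\mathcal J}(\alpha;P)$ in $[0,\infty]$ by $$k_{\mathcal J}(\tau;P)=\sup_{P'\in\mathcal P,\,P'\le P}\ \inf\Big\{\max_{1\le j\le n}|[T_j,A]|_{\mathcal J}: A\in\mathcal R_1^+,\ AP'=P'\Big\},$$ $$k_{\mathcal J}(\alpha;P)=\sup_{P'\in\mathcal P,\,P'\le P}\ \inf\Big\{\max_{1\le j\le n}|\alpha_j(A)-A|_{\mathcal J}: A\in\mathcal R_1^+,\ AP'=P'\Big\}.$$ Then there is a unique projection $E^0_{\mathcal J}(\tau)\in\mathrm{Proj}(\mathcal M)$ (the $\mathcal J$-singular projection of $\tau$) such that, for every $P\in\mathrm{Proj}(\mathcal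 M)$, $$k_{\mathcal J}(\tau;P)=0\iff P\le E^0_{\mathcal J}(\tau).$$ If $\beta$ is a $*$-automorphism of $\mathcal M$ which preserves $\rho$ and $\beta(T_j)=T_j$ for $1\le j\le n$, then $\beta(E^0_{\mathcal J}(\tau))=E^0_{\mathcal J}(\tau)$. Likewise there is a unique projection $E^0_{\mathcal J}(\alpha)\in\mathrm{Proj}(\mathcal M)$ such that, for every $P\in\mathrm{Proj}(\mathcal M)$, $$k_{\mathcal J}(\alpha;P)=0\iff P\le E^0_{\mathcal J}(\alpha).$$ If $\beta$ is a $*$-automorphism of $\mathcal M$ which preserves $\rho$ and $\beta\circ\alpha_j=\alpha_j\circ\beta$ for $1\le j\le n$, then $\beta(E^0_{\mathcal J}(\alpha))=E^0_{\mathcal J}(\alpha)$. -/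

import Mathlib

open scoped ENNReal NNReal Topology
open Filter

noncomputable section

namespace QuasicentralModulus

variable {H : Type*} [NormedAddCommGroup H] [InnerProductSpace ℂ H] [CompleteSpace H]

/-- The elements of the von Neumann algebra `M ⊆ B(H)`, as a type. It carries the `*`-algebra
structure, the operator norm and the (Loewner) order inherited from `B(H)`. -/
abbrev Elt (M : VonNeumannAlgebra H) : Type _ := M.toStarSubalgebra

/-- The absolute value `|x| = (x* x)^{1/2}` of an element of `M` belongs to `M`. -/
theorem abs_mem {M : VonNeumannAlgebra H} (x : Elt M) :
    CFC.abs (x : H →L[ℂ] H) ∈ M.toStarSubalgebra := by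
  have hx : (x : H →L[ℂ] H) ∈ (M : Set (H →L[ℂ] H)) := x.2
  have hxs : star (x : H →L[ℂ] H) ∈ (M : Set (H →L[ℂ] H)) := star_mem (s := M) hx
  change CFC.abs (x : H →L[ℂ] H) ∈ (M : Set (H →L[ℂ] H))
  rw [← M.centralizer_centralizer] at hx hxs ⊢
  intro y hy
  have hy' : star y ∈ Set.centralizer (M : Set (H →L[ℂ] H)) := by
    rw [← M.coe_commutant] at hy ⊢
    exact star_mem (s := M.commutant) hy
  exact (Commute.cfcAbs_left (hx y hy).symm (hx (star y) hy').symm).eq.symm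

/-- The absolute value `|x| = (x* x)^{1/2}` as an element of `M`. -/
def absElt {M : VonNeumannAlgebra H} (x : Elt M) : Elt M :=
  ⟨CFC.abs (x : H →L[ℂ] H), abs_mem x⟩

/-- A faithful normal semifinite trace on `M`: a map from the positive cone of `M` to `[0, ∞]`.
It is written as a function on all of `M`; only its values on positive elements are constrained
and only these are ever used. -/
structure FaithfulNormalSemifiniteTrace (M : VonNeumannAlgebra H) where
  /-- the value of the trace (meaningful on positive elements) -/
  val : Elt M → ℝ≥0∞
  map_add : ∀ x y : Elt M, 0 ≤ x → 0 ≤ y → val (x + y) = val x + val y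
  map_smul : ∀ (c : ℝ≥0) (x : Elt M), 0 ≤ x → val (((c : ℝ) : ℂ) • x) = (c : ℝ≥0∞) * val x
  /-- trace property -/
  map_star_mul_self : ∀ x : Elt M, val (star x * x) = val (x * star x)
  faithful : ∀ x : Elt M, 0 ≤ x → val x = 0 → x = 0
  /-- normality: suprema of bounded upward directed families of positive elements are preserved -/
  normal : ∀ (S : Set (Elt M)) (x : Elt M), S.Nonempty → DirectedOn (· ≤ ·) S →
    (∀ s ∈ S, 0 ≤ s) → IsLUB S x → val x = ⨆ s ∈ S, val s
  /-- semifiniteness: below each nonzero positive element there is a nonzero positive element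
  of finite trace -/
  semifinite : ∀ x : Elt M, 0 ≤ x → x ≠ 0 → ∃ y : Elt M, 0 ≤ y ∧ y ≤ x ∧ y ≠ 0 ∧ val y < ∞

variable {M : VonNeumannAlgebra H}

namespace FaithfulNormalSemifiniteTrace

variable (ρ : FaithfulNormalSemifiniteTrace M)

/-- `𝒫(M)`: the selfadjoint projections of `M` of finite trace. -/
def finProj : Set (Elt M) := {P | IsStarProjection P ∧ ρ.val P < ∞}

/-- `ℛ`: the elements `x` of `M` such that `x P = x` for a projection `P` of finite trace. -/
def finRank : Set (Elt M) := {x | ∃ P ∈ ρ.finProj, x * P = x}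

/-- `ℛ₁⁺`: the positive contractions in `ℛ`. -/
def finRankPosContr : Set (Elt M) := {a | a ∈ ρ.finRank ∧ 0 ≤ a ∧ a ≤ 1}

/-- The norm `|x|₁ = ρ(|x|)`, with values in `[0, ∞]`. -/
def norm₁ (x : Elt M) : ℝ≥0∞ := ρ.val (absElt x)

/-- `L¹(M, ρ) ∩ M`. -/
def l1 : Set (Elt M) := {x | ρ.norm₁ x < ∞}

/-- The generalized singular values
`μ(t, x) = inf {‖x (1 - P)‖ : P a projection of M with ρ(P) ≤ t}`, for `t > 0`. -/
def singularValue (t : ℝ) (x : Elt M) : ℝ :=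
  sInf {r | ∃ P ∈ ρ.finProj, ρ.val P ≤ ENNReal.ofReal t ∧ r = ‖x * (1 - P)‖}

/-- The `*`-automorphism `β` of `M` preserves the trace. -/
def IsPreservedBy (β : Elt M ≃⋆ₐ[ℂ] Elt M) : Prop :=
  ∀ x : Elt M, 0 ≤ x → ρ.val (β x) = ρ.val x

end FaithfulNormalSemifiniteTrace

/-- A symmetric operator norm `|·|_J` on `L¹(M, ρ) ∩ M`. It is written as a real function on all
of `M`; only its values on `L¹(M, ρ) ∩ M` are constrained. -/
structure SymmetricOperatorNorm (ρ : FaithfulNormalSemifiniteTrace M) where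
  /-- the value of the norm (meaningful on `L¹(M, ρ) ∩ M`) -/
  val : Elt M → ℝ
  add_le : ∀ x ∈ ρ.l1, ∀ y ∈ ρ.l1, val (x + y) ≤ val x + val y
  smul_eq : ∀ (c : ℂ), ∀ x ∈ ρ.l1, val (c • x) = ‖c‖ * val x
  nonneg : ∀ x ∈ ρ.l1, 0 ≤ val x
  eq_zero : ∀ x ∈ ρ.l1, val x = 0 → x = 0
  /-- the norm is monotone in the generalized singular values -/
  mono : ∀ x ∈ ρ.l1, ∀ y ∈ ρ.l1,
    (∀ t : ℝ, 0 < t → ρ.singularValue t x ≤ ρ.singularValue t y) → val x ≤ val y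
  /-- comparison with the trace norm and the operator norm, from below -/
  lower : ∃ C₁ : ℝ, 0 < C₁ ∧ ∀ x ∈ ρ.l1, C₁ * min (ρ.norm₁ x).toReal ‖x‖ ≤ val x
  /-- comparison with the trace norm and the operator norm, from above -/
  upper : ∃ C₂ : ℝ, 0 < C₂ ∧ ∀ x ∈ ρ.l1, val x ≤ C₂ * ((ρ.norm₁ x).toReal + ‖x‖)
  /-- projections of small trace have small norm -/
  small : ∀ P : ℕ → Elt M, (∀ m, P m ∈ ρ.finProj) →
    Tendsto (fun m => ρ.val (P m)) atTop (𝓝 0) → Tendsto (fun m => val (P m)) atTop (𝓝 0)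

namespace SymmetricOperatorNorm

variable {ρ : FaithfulNormalSemifiniteTrace M} (J : SymmetricOperatorNorm ρ) {n : ℕ}

/-- For projections `P, Q` of finite trace and maps `D₁, …, Dₙ : M → M`, the number
`inf {max_j |D_j(A)|_J : A ∈ ℛ₁⁺, A P = P, A Q = 0}`. -/
def condenserFin (D : Fin n → Elt M → Elt M) (P Q : Elt M) : ℝ≥0∞ :=
  ⨅ A ∈ {A : Elt M | A ∈ ρ.finRankPosContr ∧ A * P = P ∧ A * Q = 0},
    ⨆ j : Fin n, ENNReal.ofReal (J.val (D j A))

/-- For arbitrary projections `P, Q` of `M`: the supremum of the preceding number over all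
projections `P' ≤ P`, `Q' ≤ Q` of finite trace. -/
def condenser (D : Fin n → Elt M → Elt M) (P Q : Elt M) : ℝ≥0∞ :=
  ⨆ P' ∈ {P' : Elt M | P' ∈ ρ.finProj ∧ P' ≤ P},
    ⨆ Q' ∈ {Q' : Elt M | Q' ∈ ρ.finProj ∧ Q' ≤ Q}, J.condenserFin D P' Q'

/-- The condenser quasicentral modulus `k_J(τ; P, Q)` of an `n`-tuple `τ = (T_j)` in `M`,
built from the commutators `[T_j, A]`. -/
def kOp (T : Fin n → Elt M) (P Q : Elt M) : ℝ≥0∞ :=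
  J.condenser (fun j A => T j * A - A * T j) P Q

/-- The condenser quasicentral modulus `k_J(α; P, Q)` of an `n`-tuple `α = (α_j)` of
automorphisms of `M`, built from the differences `α_j(A) - A`. -/
def kAut (α : Fin n → (Elt M ≃⋆ₐ[ℂ] Elt M)) (P Q : Elt M) : ℝ≥0∞ :=
  J.condenser (fun j A => α j A - A) P Q

/-- `E` is a `J`-singular projection of the `n`-tuple `τ = (T_j)`: a projection such that, for
every projection `P` of `M`, `k_J(τ; P) = k_J(τ; P, 0)` vanishes iff `P ≤ E`. -/
def IsSingularProjOp (T : Fin n → Elt M) (E : Elt M) : Prop :=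
  IsStarProjection E ∧ ∀ P : Elt M, IsStarProjection P → (J.kOp T P 0 = 0 ↔ P ≤ E)

/-- `E` is a `J`-singular projection of the `n`-tuple `α = (α_j)` of automorphisms. -/
def IsSingularProjAut (α : Fin n → (Elt M ≃⋆ₐ[ℂ] Elt M)) (E : Elt M) : Prop :=
  IsStarProjection E ∧ ∀ P : Elt M, IsStarProjection P → (J.kAut α P 0 = 0 ↔ P ≤ E)

end SymmetricOperatorNorm

end QuasicentralModulus

end

/-! Write `D j` for `A ↦ [T_j, A]` or `A ↦ α_j(A) - A`, and call a finite-trace projection `P`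
negligible when some `A ∈ ℛ₁⁺` with `A P = P` make all `|D j A|_J` arbitrarily small. The modulus of
`P` vanishes iff every finite projection below `P` is negligible. The singular projection `E` is the
supremum of the negligible projections, and everything rests on one claim
(`IsCompatible.isNegligible`): each finite `P ≤ E` is itself negligible.

Let `K` run over finite sums of negligible projections. The operators `(1 + K)⁻¹` decrease to zero
on the range of `E`, so normality and `ρ(P) < ∞` give a `K` with `ρ(P (1 + K)⁻¹ P)` small. Replacing
each summand of `K` by a witness `A` gives `G ≥ K` in `ℛ` with `|D j G|_J` small. `G` need not be a
contraction, but with `X = (1 + G)⁻¹` the operator `1 - X` is one, and the resolvent identity writes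
`D j (1 - X)` as `D j G` between two contractions, so nothing is lost. As `X ≤ (1 + K)⁻¹`, `ρ(P X
P)` is still small.

Finally `1 - X` is corrected to `A = 1 - (1 - P) X (1 - P)`, which fixes `P`. The correction `P X +
X P - P X P` is small in `|·|_J` (`exists_val_compression_le`): a spectral cut of `P X P` splits `P`
into a part of small trace, where the third condition on the norm applies, and a part on which `X`
is small in operator norm.

The ideal property `|a x b|_J ≤ ‖a‖ ‖b‖ |x|_J` comes from monotonicity in the singular values.
Multiplication on the right needs left supports exchanged for right supports without increasing the
trace (`val_rangeProj_le`). Semifiniteness gives the converse, that a projection of zero modulus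
lies below `E`. -/

noncomputable section

namespace QuasicentralModulus

variable {H : Type*} [NormedAddCommGroup H] [InnerProductSpace ℂ H] [CompleteSpace H]
variable {M : VonNeumannAlgebra H}

/-! ### Resolvents `(1 + K)⁻¹` and projections in a C*-algebra. -/

section CStar

variable {A : Type*} [CStarAlgebra A] [PartialOrder A] [StarOrderedRing A]

/-- The inverse `(1 + K)⁻¹`, used for positive `K`. -/
def shiftInv (K : A) : A := Ring.inverse (1 + K)

theorem isStrictlyPositive_one_add {K : A} (hK : 0 ≤ K) : IsStrictlyPositive (1 + K) :=
  IsStrictlyPositive.add_nonneg isStrictlyPositive_one hK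

theorem one_add_mul_shiftInv {K : A} (hK : 0 ≤ K) : (1 + K) * shiftInv K = 1 :=
  Ring.mul_inverse_cancel _ (isStrictlyPositive_one_add hK).isUnit

theorem shiftInv_mul_one_add {K : A} (hK : 0 ≤ K) : shiftInv K * (1 + K) = 1 :=
  Ring.inverse_mul_cancel _ (isStrictlyPositive_one_add hK).isUnit

theorem shiftInv_anti {K L : A} (hK : 0 ≤ K) (hKL : K ≤ L) : shiftInv L ≤ shiftInv K :=
  CStarAlgebra.ringInverse_le_ringInverse (by gcongr) (isStrictlyPositive_one_add hK)

theorem shiftInv_le_one {K : A} (hK : 0 ≤ K) : shiftInv K ≤ 1 := by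
  simpa [shiftInv] using shiftInv_anti le_rfl hK

theorem shiftInv_nonneg {K : A} (hK : 0 ≤ K) : 0 ≤ shiftInv K := by
  have h : star (shiftInv K) = shiftInv K := by
    have h1 : star ((1 + K) * shiftInv K) = 1 := by rw [one_add_mul_shiftInv hK, star_one]
    have h2 : star (1 + K) = 1 + K := (isStrictlyPositive_one_add hK).isSelfAdjoint
    rw [star_mul, h2] at h1
    calc star (shiftInv K) = star (shiftInv K) * ((1 + K) * shiftInv K) := by
          rw [one_add_mul_shiftInv hK, mul_one]
      _ = shiftInv K := by rw [← mul_assoc, h1, one_mul]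
  have h3 : shiftInv K = star (shiftInv K) * (1 + K) * shiftInv K := by
    rw [h, shiftInv_mul_one_add hK, one_mul]
  rw [h3]
  exact star_left_conjugate_nonneg (isStrictlyPositive_one_add hK).nonneg _

theorem norm_shiftInv_le_one {K : A} (hK : 0 ≤ K) : ‖shiftInv K‖ ≤ 1 :=
  (CStarAlgebra.norm_le_one_iff_of_nonneg _ (shiftInv_nonneg hK)).2 (shiftInv_le_one hK)

theorem mul_shiftInv {K : A} (hK : 0 ≤ K) : K * shiftInv K = 1 - shiftInv K := by
  have h := one_add_mul_shiftInv hK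
  rw [add_mul, one_mul] at h
  rw [← h]; abel

theorem shiftInv_mul {K : A} (hK : 0 ≤ K) : shiftInv K * K = 1 - shiftInv K := by
  have h := shiftInv_mul_one_add hK
  rw [mul_add, mul_one] at h
  rw [← h]; abel

/-- Intertwining: `x (1 + K)⁻¹ = (1 + L)⁻¹ x` as soon as `x K = L x`. -/
theorem shiftInv_intertwine {K L x : A} (hK : 0 ≤ K) (hL : 0 ≤ L) (h : x * K = L * x) :
    x * shiftInv K = shiftInv L * x := by
  calc x * shiftInv K = shiftInv L * ((1 + L) * x) * shiftInv K := by
        rw [← mul_assoc, shiftInv_mul_one_add hL, one_mul]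
    _ = shiftInv L * (x * ((1 + K) * shiftInv K)) := by
        rw [add_mul, one_mul, ← h, ← mul_assoc x, mul_add x, mul_one, mul_assoc]
    _ = shiftInv L * x := by rw [one_add_mul_shiftInv hK, mul_one]

/-- The second resolvent identity. -/
theorem shiftInv_mul_sub_mul_shiftInv {K L : A} (hK : 0 ≤ K) (hL : 0 ≤ L) (T : A) :
    shiftInv L * (T * K - L * T) * shiftInv K = shiftInv L * T - T * shiftInv K := by
  calc shiftInv L * (T * K - L * T) * shiftInv K
      = shiftInv L * T * (K * shiftInv K) - (shiftInv L * L) * T * shiftInv K := by noncomm_ring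
    _ = _ := by rw [mul_shiftInv hK, shiftInv_mul hL]; noncomm_ring

/-- A projection which is dominated by a multiple of another one is a subprojection. -/
theorem proj_le_of_smul_le {P R : A} (hP : IsStarProjection P) (hR : IsStarProjection R)
    {s c : ℝ} (hs : 0 < s) (h : s • R ≤ c • P) : R ≤ P := by
  -- Compressing to `1 - P` kills the right-hand side, which forces `R (1 - P) = 0`.
  have h1 : (1 - P) * (s • R) * (1 - P) ≤ (1 - P) * (c • P) * (1 - P) :=
    IsSelfAdjoint.conjugate_le_conjugate h hP.one_sub.isSelfAdjoint
  have h2 : (1 - P) * (c • P) * (1 - P) = 0 := by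
    rw [mul_smul_comm, hP.one_sub_mul_self, smul_zero, zero_mul]
  rw [h2, mul_smul_comm, smul_mul_assoc] at h1
  have h3 : (1 - P) * R * (1 - P) = star (R * (1 - P)) * (R * (1 - P)) := by
    rw [star_mul, hR.isSelfAdjoint.star_eq, hP.one_sub.isSelfAdjoint.star_eq, mul_assoc, mul_assoc,
      ← mul_assoc R R, hR.isIdempotentElem.eq]
  have h4 : (1 - P) * R * (1 - P) ≤ 0 := by
    have := smul_le_smul_of_nonneg_left h1 (inv_nonneg.2 hs.le)
    simpa [smul_smul, inv_mul_cancel₀ hs.ne'] using this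
  have h5 : star (R * (1 - P)) * (R * (1 - P)) = 0 :=
    le_antisymm (h3 ▸ h4) (star_mul_self_nonneg _)
  have h6 : R * (1 - P) = 0 := CStarRing.star_mul_self_eq_zero_iff _ |>.1 h5
  rw [hR.le_iff_mul_eq_left hP]
  rw [mul_sub, mul_one, sub_eq_zero] at h6
  exact h6.symm

theorem mul_eq_zero_of_conj_le_zero {a x : A} (ha : 0 ≤ a) (h : star x * a * x ≤ 0) :
    a * x = 0 := by
  obtain ⟨b, hb⟩ := CStarAlgebra.nonneg_iff_eq_star_mul_self.1 ha
  have h0 : star (b * x) * (b * x) = 0 := by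
    refine le_antisymm ?_ (star_mul_self_nonneg _)
    rwa [star_mul, mul_assoc, ← mul_assoc (star b), ← hb, ← mul_assoc]
  rw [hb, mul_assoc, CStarRing.star_mul_self_eq_zero_iff _ |>.1 h0, mul_zero]

/-- The hypotheses make `Y` block diagonal for `R`, with corner `s R + a ≥ s R` and a positive
complementary corner. -/
theorem smul_proj_le {R Y a : A} {s : ℝ} (hR : IsStarProjection R) (hY : 0 ≤ Y)
    (ha : 0 ≤ a) (h : Y * R = s • R + a) (h' : R * Y = s • R + a) : s • R ≤ Y := by
  have h1 : Y = (s • R + a) + (1 - R) * Y * (1 - R) := by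
    have : R * Y * R = s • R + a := by rw [h', ← h, mul_assoc, hR.isIdempotentElem.eq]
    calc Y = R * Y + Y * R - R * Y * R + (1 - R) * Y * (1 - R) := by noncomm_ring
      _ = _ := by rw [this, h, h']; abel
  have h2 : 0 ≤ (1 - R) * Y * (1 - R) :=
    IsSelfAdjoint.conjugate_nonneg hY hR.one_sub.isSelfAdjoint
  rw [h1, add_assoc]
  exact le_add_of_nonneg_right (add_nonneg ha h2)

/-- If `0 ≤ A ≤ 1` fixes the projection `P`, then `P ≤ A`. -/
theorem proj_le_of_mul_eq {P B : A} (hP : IsStarProjection P) (hB : 0 ≤ B) (h : B * P = P) :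
    P ≤ B := by
  have hPB : P * B = P := by
    have := congrArg star h
    rwa [star_mul, hB.isSelfAdjoint.star_eq, hP.isSelfAdjoint.star_eq] at this
  have h1 : B = P + (1 - P) * B * (1 - P) := by
    have : P * B * P = P := by rw [hPB, hP.isIdempotentElem.eq]
    calc B = P * B + B * P - P * B * P + (1 - P) * B * (1 - P) := by noncomm_ring
      _ = _ := by rw [this, h, hPB]; abel
  rw [h1]
  exact le_add_of_nonneg_right (IsSelfAdjoint.conjugate_nonneg hB hP.one_sub.isSelfAdjoint)

theorem sq_le_self_of_le_one {X : A} (h0 : 0 ≤ X) (h1 : X ≤ 1) : X * X ≤ X := by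
  obtain ⟨b, hb0, hb⟩ : ∃ b : A, 0 ≤ b ∧ b * b = X :=
    ⟨CFC.sqrt X, CFC.sqrt_nonneg _, CFC.sqrt_mul_sqrt_self X h0⟩
  have := IsSelfAdjoint.conjugate_le_conjugate h1 hb0.isSelfAdjoint
  rw [mul_one, hb] at this
  calc X * X = b * X * b := by rw [← hb]; noncomm_ring
    _ ≤ X := this

/-- By the C*-identity `‖X P‖² = ‖P X² P‖`, and `X² ≤ X` for a positive contraction. This turns
smallness of a compression into smallness in norm. -/
theorem norm_mul_sq_le {X P : A} (hP : IsStarProjection P) (h0 : 0 ≤ X) (h1 : X ≤ 1) {s : ℝ}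
    (hs : 0 ≤ s) (h : P * X * P ≤ s • (1 : A)) : ‖X * P‖ ^ 2 ≤ s := by
  have h2 : star (X * P) * (X * P) ≤ s • (1 : A) := by
    rw [star_mul, h0.isSelfAdjoint.star_eq, hP.isSelfAdjoint.star_eq]
    calc P * X * (X * P) = P * (X * X) * P := by noncomm_ring
      _ ≤ P * X * P :=
        IsSelfAdjoint.conjugate_le_conjugate (sq_le_self_of_le_one h0 h1) hP.isSelfAdjoint
      _ ≤ _ := h
  rw [sq, ← CStarRing.norm_star_mul_self]
  exact (CStarAlgebra.norm_le_iff_le_algebraMap _ hs (star_mul_self_nonneg _)).2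
    (by rwa [Algebra.algebraMap_eq_smul_one])

end CStar

/-! ### `M` as an ordered C*-algebra. -/

instance isClosed_toStarSubalgebra (M : VonNeumannAlgebra H) :
    IsClosed (M.toStarSubalgebra : Set (H →L[ℂ] H)) := by
  rw [VonNeumannAlgebra.coe_toStarSubalgebra, ← M.centralizer_centralizer]
  exact Set.isClosed_centralizer _

instance : CStarAlgebra (Elt M) := StarSubalgebra.cstarAlgebra M.toStarSubalgebra

/-- The square root commutes with whatever commutes with `x`, so the double commutant contains it.
Hence the order inherited from `B(H)` is the intrinsic C*-order of `M`. -/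
theorem sqrt_mem {x : H →L[ℂ] H} (hx : x ∈ M.toStarSubalgebra) :
    CFC.sqrt x ∈ M.toStarSubalgebra := by
  change x ∈ (M : Set (H →L[ℂ] H)) at hx
  change CFC.sqrt x ∈ (M : Set (H →L[ℂ] H))
  rw [← M.centralizer_centralizer] at hx ⊢
  intro y hy
  exact (Commute.cfcₙ_nnreal (hx y hy).symm NNReal.sqrt).eq.symm

instance : StarOrderedRing (Elt M) := by
  refine StarOrderedRing.of_nonneg_iff' (fun {x y} hxy z => ?_) fun x => ⟨fun hx => ?_, ?_⟩
  · change (z + x : H →L[ℂ] H) ≤ z + y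
    gcongr
  · refine ⟨⟨CFC.sqrt (x : H →L[ℂ] H), sqrt_mem x.2⟩, Subtype.ext ?_⟩
    have hx' : (0 : H →L[ℂ] H) ≤ x := hx
    change (x : H →L[ℂ] H) = star (CFC.sqrt (x : H →L[ℂ] H)) * CFC.sqrt (x : H →L[ℂ] H)
    rw [(CFC.sqrt_nonneg (x : H →L[ℂ] H)).isSelfAdjoint.star_eq, CFC.sqrt_mul_sqrt_self _ hx']
  · rintro ⟨s, rfl⟩
    change (0 : H →L[ℂ] H) ≤ star (s : H →L[ℂ] H) * s
    exact star_mul_self_nonneg _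

/-! ### Quadratic forms. -/

/-- The quadratic form of an element of `M`. -/
def form (x : Elt M) (η : H) : ℝ := (x : H →L[ℂ] H).reApplyInnerSelf η

theorem form_def (x : Elt M) (η : H) :
    form x η = RCLike.re (inner ℂ ((x : H →L[ℂ] H) η) η) := rfl

theorem form_sub (x y : Elt M) (η : H) : form (x - y) η = form x η - form y η := by
  simp [form_def]

theorem form_mono {x y : Elt M} (h : x ≤ y) (η : H) : form x η ≤ form y η := by
  have h' : (x : H →L[ℂ] H) ≤ y := h
  have := ((ContinuousLinearMap.le_def _ _).1 h').re_inner_nonneg_left η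
  rw [sub_apply, inner_sub_left, map_sub] at this
  exact sub_nonneg.1 this

theorem form_nonneg {x : Elt M} (h : 0 ≤ x) (η : H) : 0 ≤ form x η := by
  simpa [form_def] using form_mono h η

theorem le_of_form_le {x y : Elt M} (hx : IsSelfAdjoint x) (hy : IsSelfAdjoint y)
    (h : ∀ η, form x η ≤ form y η) : x ≤ y := by
  change (x : H →L[ℂ] H) ≤ y
  rw [ContinuousLinearMap.le_def, ContinuousLinearMap.isPositive_def]
  refine ⟨?_, fun η => ?_⟩
  · have : IsSelfAdjoint ((y - x : Elt M) : H →L[ℂ] H) := congrArg Subtype.val (hy.sub hx)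
    exact this.isSymmetric
  · have := form_sub y x η
    change 0 ≤ form (y - x) η
    rw [this]
    exact sub_nonneg.2 (h η)

theorem form_conj {p x : Elt M} (hp : IsSelfAdjoint p) (η : H) :
    form (p * x * p) η = form x ((p : H →L[ℂ] H) η) := by
  have h : ContinuousLinearMap.adjoint (p : H →L[ℂ] H) = p := congrArg Subtype.val hp
  simp only [form_def]
  conv_rhs => rw [← ContinuousLinearMap.adjoint_inner_left, h]
  rfl

theorem form_le_norm_sq {x : Elt M} (h : x ≤ 1) (η : H) : form x η ≤ ‖η‖ ^ 2 := by
  refine (form_mono h η).trans_eq ?_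
  rw [form_def]
  exact inner_self_eq_norm_sq (𝕜 := ℂ) η

theorem form_add_le {x : Elt M} (h : 0 ≤ x) (η ζ : H) :
    form x (η + ζ) ≤ 2 * form x η + 2 * form x ζ := by
  have h1 : form x (η + ζ) + form x (η - ζ) = 2 * form x η + 2 * form x ζ := by
    simp only [form_def, map_add, map_sub, inner_add_left, inner_add_right, inner_sub_left,
      inner_sub_right]
    ring
  linarith [form_nonneg h (η - ζ)]

theorem form_smul (x : Elt M) (c : ℂ) (η : H) : form x (c • η) = ‖c‖ ^ 2 * form x η := by
  simp only [form_def, map_smul, inner_smul_left, inner_smul_right, ← mul_assoc]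
  rw [RCLike.mul_conj, ← RCLike.ofReal_pow, RCLike.re_ofReal_mul]

/-! ### Support projections and spectral cuts. -/

/-- The closed linear span of the ranges of the elements of a set of operators. -/
def supportSpace (S : Set (Elt M)) : Submodule ℂ H :=
  (Submodule.span ℂ {ξ | ∃ K ∈ S, ∃ η, (K : H →L[ℂ] H) η = ξ}).topologicalClosure

theorem supportSpace_le {S : Set (Elt M)} {W : Submodule ℂ H} (hW : IsClosed (W : Set H))
    (h : ∀ K ∈ S, ∀ η, (K : H →L[ℂ] H) η ∈ W) : supportSpace S ≤ W :=
  Submodule.topologicalClosure_minimal _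
    (Submodule.span_le.2 fun _ ⟨K, hK, η, hη⟩ => hη ▸ h K hK η) hW

theorem apply_mem_supportSpace {S : Set (Elt M)} {K : Elt M} (hK : K ∈ S) (η : H) :
    (K : H →L[ℂ] H) η ∈ supportSpace S :=
  Submodule.le_topologicalClosure _ (Submodule.subset_span ⟨K, hK, η, rfl⟩)

theorem isClosed_supportSpace (S : Set (Elt M)) : IsClosed (supportSpace S : Set H) :=
  Submodule.isClosed_topologicalClosure _

instance (S : Set (Elt M)) : CompleteSpace (supportSpace S) :=
  (isClosed_supportSpace S).completeSpace_coe

/-- Operators `y` in the commutant satisfy `y K η = K y η`, so they leave the support space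
invariant. -/
theorem starProjection_supportSpace_mem (S : Set (Elt M)) :
    (supportSpace S).starProjection ∈ M.toStarSubalgebra := by
  change (supportSpace S).starProjection ∈ M
  rw [VonNeumannAlgebra.IsStarProjection.mem_iff isStarProjection_starProjection]
  intro y hy
  rw [Submodule.range_starProjection]
  rw [VonNeumannAlgebra.mem_commutant_iff] at hy
  refine supportSpace_le (W := (supportSpace S).comap (y : H →ₗ[ℂ] H))
    ((isClosed_supportSpace S).preimage y.continuous) fun K hK η => ?_
  have h1 := congrArg (fun T : H →L[ℂ] H => T η) (hy K K.2)
  have h2 : y ((K : H →L[ℂ] H) η) = (K : H →L[ℂ] H) (y η) := h1.symm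
  change y ((K : H →L[ℂ] H) η) ∈ supportSpace S
  rw [h2]
  exact apply_mem_supportSpace hK _

/-- The projection onto the closed linear span of the ranges of a set of elements of `M`. -/
def supportProj (S : Set (Elt M)) : Elt M :=
  ⟨(supportSpace S).starProjection, starProjection_supportSpace_mem S⟩

theorem isStarProjection_supportProj (S : Set (Elt M)) : IsStarProjection (supportProj S) where
  isIdempotentElem := Subtype.ext
    (isStarProjection_starProjection (U := supportSpace S)).isIdempotentElem
  isSelfAdjoint := Subtype.ext
    (isStarProjection_starProjection (U := supportSpace S)).isSelfAdjoint

theorem supportProj_mul {S : Set (Elt M)} {K : Elt M} (hK : K ∈ S) : supportProj S * K = K :=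
  Subtype.ext <| ContinuousLinearMap.ext fun η =>
    Submodule.starProjection_eq_self_iff.2 (apply_mem_supportSpace hK η)

theorem mul_supportProj_eq_zero {S : Set (Elt M)} {y : Elt M} (h : ∀ K ∈ S, y * K = 0) :
    y * supportProj S = 0 := by
  have h1 : supportSpace S ≤ LinearMap.ker ((y : H →L[ℂ] H) : H →ₗ[ℂ] H) :=
    supportSpace_le (y : H →L[ℂ] H).isClosed_ker fun K hK η =>
      congrArg (fun T : Elt M => (T : H →L[ℂ] H) η) (h K hK)
  exact Subtype.ext <| ContinuousLinearMap.ext fun η =>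
    h1 (Submodule.starProjection_apply_mem (supportSpace S) η)

theorem supportProj_le {S : Set (Elt M)} {P : Elt M} (hP : IsStarProjection P)
    (h : ∀ K ∈ S, P * K = K) : supportProj S ≤ P := by
  rw [(isStarProjection_supportProj S).le_iff_mul_eq_right hP]
  have : (1 - P) * supportProj S = 0 :=
    mul_supportProj_eq_zero fun K hK => by rw [sub_mul, one_mul, h K hK, sub_self]
  rw [sub_mul, one_mul, sub_eq_zero] at this
  exact this.symm

/-- For an additive monoid `S` of positive operators, the quadratic forms of the operators
`(1 + K)⁻¹`, `K ∈ S`, decrease to zero on the support space of `S`. -/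
theorem exists_form_shiftInv_le {S : AddSubmonoid (Elt M)} (hS : ∀ K ∈ S, 0 ≤ K) {η : H}
    (hη : η ∈ supportSpace (S : Set (Elt M))) {ε : ℝ} (hε : 0 < ε) :
    ∃ K ∈ S, form (shiftInv K) η ≤ ε := by
  -- The vectors with the desired property form a closed subspace, so it suffices to test vectors `K
  -- η`. For sums, `K + L` serves both vectors and the parallelogram law costs a factor 2 on each
  -- term, hence `ε / 4`.
  let W : Submodule ℂ H :=
    { carrier := {η | ∀ ε : ℝ, 0 < ε → ∃ K ∈ S, form (shiftInv K) η ≤ ε}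
      zero_mem' := fun ε hε => ⟨0, S.zero_mem, by simpa [form_def] using hε.le⟩
      add_mem' := by
        intro η ζ h1 h2 ε hε
        obtain ⟨K, hK, hK'⟩ := h1 (ε / 4) (by positivity)
        obtain ⟨L, hL, hL'⟩ := h2 (ε / 4) (by positivity)
        refine ⟨K + L, S.add_mem hK hL, ?_⟩
        have h3 := form_mono (shiftInv_anti (hS K hK) (le_add_of_nonneg_right (hS L hL))) η
        have h4 := form_mono (shiftInv_anti (hS L hL) (le_add_of_nonneg_left (hS K hK))) ζ
        have h5 := form_add_le (shiftInv_nonneg (add_nonneg (hS K hK) (hS L hL))) η ζ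
        linarith
      smul_mem' := by
        intro c η h1 ε hε
        obtain ⟨K, hK, hK'⟩ := h1 (ε / (‖c‖ ^ 2 + 1)) (by positivity)
        refine ⟨K, hK, ?_⟩
        rw [form_smul]
        have h2 := form_nonneg (shiftInv_nonneg (hS K hK)) η
        rw [le_div_iff₀ (by positivity)] at hK'
        nlinarith }
  have hW : IsClosed (W : Set H) := by
    refine isClosed_of_closure_subset fun η h ε hε => ?_
    obtain ⟨ζ, hζ, hd⟩ := Metric.mem_closure_iff.1 h (√(ε / 4)) (by positivity)
    obtain ⟨K, hK, hK'⟩ := hζ (ε / 4) (by positivity)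
    refine ⟨K, hK, ?_⟩
    have h1 := form_add_le (shiftInv_nonneg (hS K hK)) ζ (η - ζ)
    have h2 := form_le_norm_sq (shiftInv_le_one (hS K hK)) (η - ζ)
    have h3 : ‖η - ζ‖ ^ 2 ≤ ε / 4 := by
      rw [dist_eq_norm] at hd
      exact (Real.le_sqrt (norm_nonneg _) (by positivity)).1 hd.le
    rw [add_sub_cancel] at h1
    linarith
  refine supportSpace_le hW (fun K hK η ε hε => ?_) hη ε hε
  -- Use the multiple `m K ∈ S`: with `b = (1 + m K)⁻¹` one has `m K b K = (1 - b) K`, so `‖K b K‖ ≤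
  -- 2 ‖K‖ / m`.
  obtain ⟨m, hm⟩ := exists_nat_gt (2 * ‖K‖ * ‖η‖ ^ 2 / ε)
  have hm0 : (0 : ℝ) < m := lt_of_le_of_lt (by positivity) hm
  have hmK : m • K ∈ S := S.nsmul_mem hK m
  refine ⟨m • K, hmK, ?_⟩
  have hb := mul_shiftInv (hS _ hmK)
  set b := shiftInv (m • K) with hbdef
  have hK0 : (0 : Elt M) ≤ K := hS K hK
  rw [← form_conj hK0.isSelfAdjoint]
  have h1 : (m : ℝ) • (K * b * K) = (1 - b) * K := by
    rw [← hb, ← smul_mul_assoc, ← smul_mul_assoc, ← Nat.cast_smul_eq_nsmul ℝ]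
  have hbn : ‖1 - b‖ ≤ 2 := by
    refine (norm_sub_le _ _).trans ?_
    have h4 : ‖(1 : Elt M)‖ ≤ 1 := (IsStarProjection.one (R := Elt M)).norm_le
    have h5 := norm_shiftInv_le_one (hS _ hmK)
    linarith
  have h2 : m * ‖K * b * K‖ ≤ 2 * ‖K‖ := by
    calc m * ‖K * b * K‖ = ‖(m : ℝ) • (K * b * K)‖ := by rw [norm_smul]; simp
      _ ≤ ‖1 - b‖ * ‖K‖ := by rw [h1]; exact norm_mul_le _ _
      _ ≤ 2 * ‖K‖ := by gcongr
  have h3 : form (K * b * K) η ≤ ‖K * b * K‖ * ‖η‖ ^ 2 := by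
    refine (RCLike.re_le_norm _).trans ((norm_inner_le_norm _ _).trans ?_)
    rw [sq, ← mul_assoc]
    gcongr
    exact ContinuousLinearMap.le_opNorm _ _
  rw [div_lt_iff₀ hε] at hm
  have h6 : m * form (K * b * K) η ≤ m * ε := by
    calc m * form (K * b * K) η ≤ m * (‖K * b * K‖ * ‖η‖ ^ 2) := by gcongr
      _ = m * ‖K * b * K‖ * ‖η‖ ^ 2 := by ring
      _ ≤ 2 * ‖K‖ * ‖η‖ ^ 2 := by gcongr
      _ ≤ m * ε := hm.le
  exact le_of_mul_le_mul_left h6 hm0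

theorem isLUB_sub_conj_shiftInv {S : AddSubmonoid (Elt M)} (hS : ∀ K ∈ S, 0 ≤ K) {P : Elt M}
    (hP : IsStarProjection P) (hPS : supportProj (S : Set (Elt M)) * P = P) :
    IsLUB ((fun K => P - P * shiftInv K * P) '' (S : Set (Elt M))) P := by
  constructor
  · rintro _ ⟨K, hK, rfl⟩
    exact sub_le_self _ (IsSelfAdjoint.conjugate_nonneg (shiftInv_nonneg (hS K hK))
      hP.isSelfAdjoint)
  · intro X hX
    have hX' : ∀ K ∈ S, P - P * shiftInv K * P ≤ X := fun K hK => hX ⟨K, hK, rfl⟩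
    -- The index `K = 0` contributes `P - P * 1 * P = 0`.
    have hX0 : 0 ≤ X := by
      have := hX' 0 S.zero_mem
      simpa [shiftInv, hP.isIdempotentElem.eq] using this
    refine le_of_form_le hP.isSelfAdjoint hX0.isSelfAdjoint fun ξ =>
      le_of_forall_pos_le_add fun ε hε => ?_
    have hξ : (P : H →L[ℂ] H) ξ ∈ supportSpace (S : Set (Elt M)) := by
      have : (supportSpace (S : Set (Elt M))).starProjection ((P : H →L[ℂ] H) ξ)
          = (P : H →L[ℂ] H) ξ := congrArg (fun T : Elt M => (T : H →L[ℂ] H) ξ) hPS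
      rw [← this]
      exact Submodule.starProjection_apply_mem _ _
    obtain ⟨K, hK, hKε⟩ := exists_form_shiftInv_le hS hξ hε
    have h1 := form_mono (hX' K hK) ξ
    rw [form_sub, form_conj hP.isSelfAdjoint] at h1
    linarith

/-- A crude spectral cut at height `s`: a projection `R` on which `Y ≥ s` and off which `Y ≤ s`. -/
theorem exists_spectral_cut {Y : Elt M} (hY : 0 ≤ Y) {s : ℝ} (hs : 0 < s) :
    ∃ R : Elt M, IsStarProjection R ∧ s • R ≤ Y ∧ (1 - R) * Y * (1 - R) ≤ s • (1 : Elt M) ∧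
      (R = 0 → Y ≤ s • (1 : Elt M)) := by
  have ha : IsSelfAdjoint (Y - s • (1 : Elt M)) :=
    hY.isSelfAdjoint.sub (IsSelfAdjoint.smul (IsSelfAdjoint.all s) (IsSelfAdjoint.one _))
  -- `p` and `q` are the positive and negative parts of `Y - s`. The range projection of `p` serves
  -- as `R`; it is annihilated by `q`.
  obtain ⟨p, q, hp, hq, hqp, hpq⟩ : ∃ p q : Elt M, 0 ≤ p ∧ 0 ≤ q ∧ q * p = 0 ∧
      p - q = Y - s • (1 : Elt M) :=
    ⟨_, _, CFC.posPart_nonneg _, CFC.negPart_nonneg _, CFC.negPart_mul_posPart _,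
      CFC.posPart_sub_negPart _ ha⟩
  have hYe : Y = s • (1 : Elt M) + p - q := by rw [add_sub_assoc, hpq]; abel
  have hR := isStarProjection_supportProj ({p} : Set (Elt M))
  have hRp : supportProj {p} * p = p := supportProj_mul (Set.mem_singleton p)
  have hqR : q * supportProj {p} = 0 := mul_supportProj_eq_zero fun K hK => by
    rw [Set.mem_singleton_iff.1 hK, hqp]
  set R := supportProj ({p} : Set (Elt M))
  have hpR : p * R = p := by
    have := congrArg star hRp
    rwa [star_mul, hp.isSelfAdjoint.star_eq, hR.isSelfAdjoint.star_eq] at this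
  have hRq : R * q = 0 := by
    have := congrArg star hqR
    rwa [star_mul, hq.isSelfAdjoint.star_eq, hR.isSelfAdjoint.star_eq, star_zero] at this
  refine ⟨R, hR, smul_proj_le hR hY hp ?_ ?_, ?_, fun h0 => ?_⟩
  · rw [hYe, sub_mul, add_mul, hqR, hpR, smul_mul_assoc, one_mul, sub_zero]
  · rw [hYe, mul_sub, mul_add, hRq, hRp, mul_smul_comm, mul_one, sub_zero]
  · have h1 : (1 - R) * Y * (1 - R) = s • (1 - R) - q := by
      have e1 : (1 - R) * Y = s • (1 - R) - q := by
        rw [hYe, mul_sub, mul_add, sub_mul 1 R p, sub_mul 1 R q, hRq, hRp, mul_smul_comm, mul_one,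
          one_mul, one_mul, sub_self, add_zero, sub_zero]
      rw [e1, sub_mul, mul_sub q, mul_one, hqR, sub_zero, smul_mul_assoc,
        hR.one_sub.isIdempotentElem.eq]
    rw [h1]
    calc s • (1 - R) - q ≤ s • (1 - R) := sub_le_self _ hq
      _ ≤ s • 1 := smul_le_smul_of_nonneg_left (sub_le_self _ hR.nonneg) hs.le
  · have : p = 0 := by rw [← hRp, h0, zero_mul]
    rw [hYe, this, add_zero]
    exact sub_le_self _ hq

/-! ### The trace: normality, range projections, the ideal `ℛ`. -/

namespace FaithfulNormalSemifiniteTrace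

variable (ρ : FaithfulNormalSemifiniteTrace M)

theorem val_mono {x y : Elt M} (hx : 0 ≤ x) (hxy : x ≤ y) : ρ.val x ≤ ρ.val y := by
  have := ρ.map_add x (y - x) hx (sub_nonneg.2 hxy)
  rw [add_sub_cancel] at this
  rw [this]
  exact le_self_add

theorem val_smul {s : ℝ} (hs : 0 ≤ s) {x : Elt M} (hx : 0 ≤ x) :
    ρ.val (s • x) = ENNReal.ofReal s * ρ.val x :=
  ρ.map_smul ⟨s, hs⟩ x hx |>.trans (by rw [ENNReal.ofReal_eq_coe_nnreal hs]; rfl)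

theorem val_zero : ρ.val 0 = 0 := by
  simpa using ρ.val_smul (le_refl (0 : ℝ)) (le_refl (0 : Elt M))

theorem zero_mem_finProj : (0 : Elt M) ∈ ρ.finProj :=
  ⟨IsStarProjection.zero _, by rw [ρ.val_zero]; exact ENNReal.zero_lt_top⟩

variable {ρ}

theorem val_eq_iSup_sub_conj {S : AddSubmonoid (Elt M)} (hS : ∀ K ∈ S, 0 ≤ K) {P : Elt M}
    (hP : IsStarProjection P) (hPS : supportProj (S : Set (Elt M)) * P = P) :
    ρ.val P = ⨆ K ∈ S, ρ.val (P - P * shiftInv K * P) := by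
  rw [ρ.normal _ P (Set.Nonempty.image _ ⟨0, S.zero_mem⟩) ?_ ?_
    (isLUB_sub_conj_shiftInv hS hP hPS), iSup_image]
  · rfl
  · rintro _ ⟨K, hK, rfl⟩ _ ⟨L, hL, rfl⟩
    refine ⟨_, ⟨K + L, S.add_mem hK hL, rfl⟩, ?_, ?_⟩
    · exact sub_le_sub_left (IsSelfAdjoint.conjugate_le_conjugate
        (shiftInv_anti (hS K hK) (le_add_of_nonneg_right (hS L hL))) hP.isSelfAdjoint) _
    · exact sub_le_sub_left (IsSelfAdjoint.conjugate_le_conjugate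
        (shiftInv_anti (hS L hL) (le_add_of_nonneg_left (hS K hK))) hP.isSelfAdjoint) _
  · rintro _ ⟨K, hK, rfl⟩
    refine sub_nonneg.2 ?_
    have := IsSelfAdjoint.conjugate_le_conjugate (shiftInv_le_one (hS K hK)) hP.isSelfAdjoint
    rwa [mul_one, hP.isIdempotentElem.eq] at this

/-- Normality concerns increasing families, so it is applied to `P - P (1 + K)⁻¹ P`, with supremum
`P`. Finiteness of `ρ(P)` permits the subtraction. -/
theorem exists_val_conj_shiftInv_lt {S : AddSubmonoid (Elt M)} (hS : ∀ K ∈ S, 0 ≤ K) {P : Elt M}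
    (hP : P ∈ ρ.finProj) (hPS : supportProj (S : Set (Elt M)) * P = P) {ε : ℝ≥0∞} (hε : 0 < ε) :
    ∃ K ∈ S, ρ.val (P * shiftInv K * P) < ε := by
  by_contra! h
  obtain ⟨hP1, hP2⟩ := hP
  have h1 : ∀ K ∈ S, ρ.val (P - P * shiftInv K * P) + ε ≤ ρ.val P := by
    intro K hK
    have e0 : 0 ≤ P * shiftInv K * P :=
      IsSelfAdjoint.conjugate_nonneg (shiftInv_nonneg (hS K hK)) hP1.isSelfAdjoint
    have e1 : P * shiftInv K * P ≤ P := by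
      have := IsSelfAdjoint.conjugate_le_conjugate (shiftInv_le_one (hS K hK)) hP1.isSelfAdjoint
      rwa [mul_one, hP1.isIdempotentElem.eq] at this
    have e2 := ρ.map_add _ _ (sub_nonneg.2 e1) e0
    rw [sub_add_cancel] at e2
    rw [e2]
    gcongr
    exact h K hK
  have h2 : ρ.val P + ε ≤ ρ.val P := by
    conv_lhs => rw [val_eq_iSup_sub_conj hS hP1 hPS]
    rw [ENNReal.biSup_add' ⟨0, S.zero_mem⟩]
    exact iSup₂_le h1
  exact absurd h2 (not_le.2 (ENNReal.lt_add_right hP2.ne hε.ne'))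

/-- The trace of the range projection of `x` is at most that of a right support of `x`. -/
theorem val_rangeProj_le {x Q : Elt M} (hQ : IsStarProjection Q) (hx : x * Q = x) :
    ρ.val (supportProj {x}) ≤ ρ.val Q := by
  have hR := isStarProjection_supportProj ({x} : Set (Elt M))
  have hRx : supportProj {x} * x = x := supportProj_mul (Set.mem_singleton x)
  set R := supportProj ({x} : Set (Elt M))
  have hQx : Q * star x = star x := by
    have := congrArg star hx
    rwa [star_mul, hQ.isSelfAdjoint.star_eq] at this
  have hxR : star x * R = star x := by
    have := congrArg star hRx
    rwa [star_mul, hR.isSelfAdjoint.star_eq] at this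
  -- A substitute for polar decomposition: `R` is the supremum of `R - R (1 + m x x*)⁻¹ R`. Each of
  -- these has the form `m y* y` with `m y y* ≤ Q`, so the trace property bounds its trace by
  -- `ρ(Q)`. Here `y = c x*` with `c² = (1 + m x* x)⁻¹`.
  set S := AddSubmonoid.multiples (x * star x)
  have hS : ∀ K ∈ S, 0 ≤ K := by
    rintro _ ⟨m, rfl⟩
    exact nsmul_nonneg (mul_star_self_nonneg x) m
  have hRS : R ≤ supportProj (S : Set (Elt M)) := by
    refine supportProj_le (isStarProjection_supportProj _) fun K hK => ?_
    rw [Set.mem_singleton_iff.1 hK]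
    have h1 : supportProj (S : Set (Elt M)) * (x * star x) = x * star x :=
      supportProj_mul (AddSubmonoid.mem_multiples _)
    have h2 : ((1 - supportProj (S : Set (Elt M))) * x) *
        star ((1 - supportProj (S : Set (Elt M))) * x) = 0 := by
      rw [star_mul, mul_assoc, ← mul_assoc x, ← mul_assoc, sub_mul 1, h1, one_mul, sub_self,
        zero_mul]
    have h3 := CStarRing.mul_star_self_eq_zero_iff _ |>.1 h2
    rw [sub_mul, one_mul, sub_eq_zero] at h3
    exact h3.symm
  rw [val_eq_iSup_sub_conj hS hR
    ((hR.le_iff_mul_eq_right (isStarProjection_supportProj _)).1 hRS)]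
  refine iSup₂_le fun K hK => ?_
  obtain ⟨m, rfl⟩ := hK
  change ρ.val (R - R * shiftInv (m • (x * star x)) * R) ≤ _
  have h0 : 0 ≤ m • (x * star x) := nsmul_nonneg (mul_star_self_nonneg x) m
  have h0' : 0 ≤ m • (star x * x) := nsmul_nonneg (star_mul_self_nonneg x) m
  set b := shiftInv (m • (x * star x))
  set b' := shiftInv (m • (star x * x))
  have hb' : 0 ≤ b' := shiftInv_nonneg h0'
  have hint : star x * b = b' * star x := shiftInv_intertwine h0 h0' (by
    simp only [mul_smul_comm, smul_mul_assoc, mul_assoc])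
  have hb1 : 1 - b = m • (x * b' * star x) := by
    rw [← mul_shiftInv h0, smul_mul_assoc, mul_assoc, hint, mul_assoc]
  obtain ⟨c, hc0, hcc, hcQ⟩ : ∃ c : Elt M, 0 ≤ c ∧ c * c = b' ∧ c * Q = Q * c := by
    refine ⟨CFC.sqrt b', CFC.sqrt_nonneg _, CFC.sqrt_mul_sqrt_self _ hb', ?_⟩
    have h1 : Q * b' = b' * Q := shiftInv_intertwine h0' h0' (by
      simp only [mul_smul_comm, smul_mul_assoc]
      rw [← mul_assoc, hQx, mul_assoc, hx])
    exact (Commute.cfcₙ_nnreal (show Commute b' Q from h1.symm) NNReal.sqrt).eq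
  have hRbR : R - R * b * R = m • (star (c * star x) * (c * star x)) := by
    have h1 : star (c * star x) * (c * star x) = x * b' * star x := by
      rw [star_mul, star_star, hc0.isSelfAdjoint.star_eq, ← hcc]; noncomm_ring
    have h2 : R - R * b * R = R * (1 - b) * R := by
      rw [mul_sub, sub_mul, mul_one, hR.isIdempotentElem.eq]
    rw [h2, hb1, h1, mul_smul_comm, smul_mul_assoc, ← mul_assoc, ← mul_assoc, hRx, mul_assoc _ _ R,
      hxR]
  have hmR : ∀ z : Elt M, m • z = (m : ℝ) • z := fun z => (Nat.cast_smul_eq_nsmul ℝ m z).symm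
  have hle1 : m • (c * star x * star (c * star x)) ≤ 1 := by
    refine (CStarAlgebra.norm_le_one_iff_of_nonneg _
      (nsmul_nonneg (mul_star_self_nonneg _) m)).1 ?_
    have h1 : ‖R - R * b * R‖ ≤ 1 := by
      have h2 : R - R * b * R = R * (1 - b) * R := by
        rw [mul_sub, sub_mul, mul_one, hR.isIdempotentElem.eq]
      have h3 : ‖1 - b‖ ≤ 1 := (CStarAlgebra.norm_le_one_iff_of_nonneg _
        (sub_nonneg.2 (shiftInv_le_one h0))).2 (sub_le_self _ (shiftInv_nonneg h0))
      have hRn := hR.norm_le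
      calc ‖R - R * b * R‖ ≤ ‖R‖ * ‖1 - b‖ * ‖R‖ := by
            rw [h2]; exact (norm_mul_le _ _).trans (by gcongr; exact norm_mul_le _ _)
        _ ≤ 1 * 1 * 1 := by gcongr
        _ = 1 := by norm_num
    rw [hRbR, hmR, norm_smul, CStarRing.norm_star_mul_self] at h1
    rwa [hmR, norm_smul, CStarRing.norm_self_mul_star]
  have hleQ : m • (c * star x * star (c * star x)) ≤ Q := by
    have h1 := IsSelfAdjoint.conjugate_le_conjugate hle1 hQ.isSelfAdjoint
    rw [mul_one, hQ.isIdempotentElem.eq] at h1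
    have h2 : Q * (c * star x) = c * star x := by rw [← mul_assoc, ← hcQ, mul_assoc, hQx]
    have h3 : star (c * star x) * Q = star (c * star x) := by
      have := congrArg star h2
      rwa [star_mul, hQ.isSelfAdjoint.star_eq] at this
    rwa [mul_smul_comm, smul_mul_assoc, ← mul_assoc, h2, mul_assoc _ _ Q, h3] at h1
  calc ρ.val (R - R * b * R) = ρ.val ((m : ℝ) • (star (c * star x) * (c * star x))) := by
        rw [hRbR, hmR]
    _ = ρ.val ((m : ℝ) • (c * star x * star (c * star x))) := by
        rw [ρ.val_smul m.cast_nonneg (star_mul_self_nonneg _),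
          ρ.val_smul m.cast_nonneg (mul_star_self_nonneg _), ρ.map_star_mul_self]
    _ ≤ ρ.val Q := by
        rw [← hmR]
        exact ρ.val_mono (nsmul_nonneg (mul_star_self_nonneg _) m) hleQ

/-- A left support of `x` may be exchanged for a right support, without increasing the trace. -/
theorem exists_right_support {x P : Elt M} (hP : P ∈ ρ.finProj) (hx : P * x = x) :
    ∃ Q ∈ ρ.finProj, ρ.val Q ≤ ρ.val P ∧ x * Q = x := by
  have h1 : star x * P = star x := by
    have := congrArg star hx
    rwa [star_mul, hP.1.isSelfAdjoint.star_eq] at this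
  have h2 := val_rangeProj_le (ρ := ρ) hP.1 h1
  refine ⟨supportProj {star x}, ⟨isStarProjection_supportProj _, h2.trans_lt hP.2⟩, h2, ?_⟩
  have := congrArg star (supportProj_mul (Set.mem_singleton (star x)))
  rwa [star_mul, star_star, (isStarProjection_supportProj _).isSelfAdjoint.star_eq] at this

/-- Add to `P` the range projection of `(1 - P) Q`. It is orthogonal to `P` and has trace at most
`ρ(Q)`. -/
theorem exists_upper_bound_finProj {P Q : Elt M} (hP : P ∈ ρ.finProj) (hQ : Q ∈ ρ.finProj) :
    ∃ R ∈ ρ.finProj, P * R = P ∧ Q * R = Q := by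
  have hR := isStarProjection_supportProj ({(1 - P) * Q} : Set (Elt M))
  have h1 := val_rangeProj_le (ρ := ρ) hQ.1 (x := (1 - P) * Q)
    (by rw [mul_assoc, hQ.1.isIdempotentElem.eq])
  have h2 : P * supportProj {(1 - P) * Q} = 0 := mul_supportProj_eq_zero fun K hK => by
    rw [Set.mem_singleton_iff.1 hK, ← mul_assoc, hP.1.mul_one_sub_self, zero_mul]
  have h3 : supportProj {(1 - P) * Q} * ((1 - P) * Q) = (1 - P) * Q :=
    supportProj_mul (Set.mem_singleton _)
  set R := supportProj ({(1 - P) * Q} : Set (Elt M))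
  have h4 : R * P = 0 := by
    have := congrArg star h2
    rwa [star_mul, hR.isSelfAdjoint.star_eq, hP.1.isSelfAdjoint.star_eq, star_zero] at this
  refine ⟨P + R, ⟨⟨?_, hP.1.isSelfAdjoint.add hR.isSelfAdjoint⟩, ?_⟩, ?_, ?_⟩
  · change (P + R) * (P + R) = P + R
    rw [mul_add, add_mul, add_mul, h2, h4, hP.1.isIdempotentElem.eq, hR.isIdempotentElem.eq,
      add_zero, zero_add]
  · rw [ρ.map_add _ _ hP.1.nonneg hR.nonneg]
    exact ENNReal.add_lt_top.2 ⟨hP.2, h1.trans_lt hQ.2⟩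
  · rw [mul_add, h2, hP.1.isIdempotentElem.eq, add_zero]
  · have h5 : (P + R) * Q = Q := by
      rw [← mul_assoc, mul_sub, h4, mul_one, sub_zero, sub_mul, one_mul] at h3
      rw [add_mul, h3]; abel
    have := congrArg star h5
    rwa [star_mul, hQ.1.isSelfAdjoint.star_eq, (hP.1.isSelfAdjoint.add hR.isSelfAdjoint).star_eq]
      at this

theorem finProj_subset_finRank {P : Elt M} (hP : P ∈ ρ.finProj) : P ∈ ρ.finRank :=
  ⟨P, hP, hP.1.isIdempotentElem.eq⟩

theorem finRank_mul_left {x : Elt M} (hx : x ∈ ρ.finRank) (a : Elt M) : a * x ∈ ρ.finRank :=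
  let ⟨P, hP, h⟩ := hx
  ⟨P, hP, by rw [mul_assoc, h]⟩

theorem finRank_mul_right {x : Elt M} (hx : x ∈ ρ.finRank) (a : Elt M) : x * a ∈ ρ.finRank := by
  obtain ⟨P, hP, h⟩ := hx
  obtain ⟨Q, hQ, -, h'⟩ := exists_right_support hP (x := P * a)
    (by rw [← mul_assoc, hP.1.isIdempotentElem.eq])
  refine ⟨Q, hQ, ?_⟩
  rw [← h, mul_assoc x, mul_assoc x, h']

theorem finRank_add {x y : Elt M} (hx : x ∈ ρ.finRank) (hy : y ∈ ρ.finRank) :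
    x + y ∈ ρ.finRank := by
  obtain ⟨P, hP, h⟩ := hx
  obtain ⟨Q, hQ, h'⟩ := hy
  obtain ⟨R, hR, h1, h2⟩ := exists_upper_bound_finProj hP hQ
  refine ⟨R, hR, ?_⟩
  rw [add_mul, ← h, ← h', mul_assoc, mul_assoc, h1, h2]

theorem finRank_smul {x : Elt M} (hx : x ∈ ρ.finRank) (c : ℂ) : c • x ∈ ρ.finRank :=
  let ⟨P, hP, h⟩ := hx
  ⟨P, hP, by rw [smul_mul_assoc, h]⟩

theorem finRank_neg {x : Elt M} (hx : x ∈ ρ.finRank) : -x ∈ ρ.finRank :=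
  let ⟨P, hP, h⟩ := hx
  ⟨P, hP, by rw [neg_mul, h]⟩

theorem finRank_sub {x y : Elt M} (hx : x ∈ ρ.finRank) (hy : y ∈ ρ.finRank) :
    x - y ∈ ρ.finRank := by
  rw [sub_eq_add_neg]
  exact finRank_add hx (finRank_neg hy)

/-- `|x|` inherits the right support `Q` of `x`; being selfadjoint, it satisfies `|x| ≤ ‖x‖ Q`. -/
theorem norm₁_le {x Q : Elt M} (hQ : IsStarProjection Q) (hx : x * Q = x) :
    ρ.norm₁ x ≤ ENNReal.ofReal ‖x‖ * ρ.val Q := by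
  have h0 : 0 ≤ absElt x := CFC.abs_nonneg (x : H →L[ℂ] H)
  have h1 : absElt x * absElt x = star x * x := Subtype.ext (CFC.abs_mul_abs (x : H →L[ℂ] H))
  have hn : ‖absElt x‖ = ‖x‖ := by
    have h2 : ‖absElt x‖ * ‖absElt x‖ = ‖x‖ * ‖x‖ := by
      rw [← CStarRing.norm_star_mul_self, ← CStarRing.norm_star_mul_self (x := x),
        h0.isSelfAdjoint.star_eq, h1]
    exact (mul_self_inj (norm_nonneg _) (norm_nonneg _)).1 h2
  have h2 : absElt x * Q = absElt x := by
    have h3 : star (absElt x * (1 - Q)) * (absElt x * (1 - Q)) = 0 := by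
      rw [star_mul, h0.isSelfAdjoint.star_eq, mul_assoc, ← mul_assoc (absElt x), h1, mul_assoc,
        mul_sub x, mul_one, hx, sub_self, mul_zero, mul_zero]
    have h4 := CStarRing.star_mul_self_eq_zero_iff _ |>.1 h3
    rw [mul_sub, mul_one, sub_eq_zero] at h4
    exact h4.symm
  have h3 : Q * absElt x = absElt x := by
    have := congrArg star h2
    rwa [star_mul, h0.isSelfAdjoint.star_eq, hQ.isSelfAdjoint.star_eq] at this
  have h4 : absElt x ≤ ‖x‖ • Q := by
    have h5 : absElt x ≤ ‖x‖ • (1 : Elt M) := by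
      rw [← Algebra.algebraMap_eq_smul_one, ← hn]
      exact h0.isSelfAdjoint.le_algebraMap_norm_self
    have h6 := IsSelfAdjoint.conjugate_le_conjugate h5 hQ.isSelfAdjoint
    rwa [h3, h2, mul_smul_comm, smul_mul_assoc, mul_one, hQ.isIdempotentElem.eq] at h6
  calc ρ.norm₁ x ≤ ρ.val (‖x‖ • Q) := ρ.val_mono h0 h4
    _ = _ := ρ.val_smul (norm_nonneg _) hQ.nonneg

theorem finRank_subset_l1 {x : Elt M} (hx : x ∈ ρ.finRank) : x ∈ ρ.l1 := by
  obtain ⟨P, hP, h⟩ := hx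
  exact (norm₁_le hP.1 h).trans_lt (ENNReal.mul_lt_top ENNReal.ofReal_lt_top hP.2)

end FaithfulNormalSemifiniteTrace

/-! ### Singular values and trace-preserving automorphisms. -/

namespace FaithfulNormalSemifiniteTrace

variable {ρ : FaithfulNormalSemifiniteTrace M}

theorem singularValue_le {t : ℝ} {x Q : Elt M} (hQ : Q ∈ ρ.finProj)
    (h : ρ.val Q ≤ ENNReal.ofReal t) : ρ.singularValue t x ≤ ‖x * (1 - Q)‖ :=
  csInf_le ⟨0, by rintro _ ⟨P, -, -, rfl⟩; exact norm_nonneg _⟩ ⟨Q, hQ, h, rfl⟩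

theorem le_singularValue {t r : ℝ} {x : Elt M}
    (h : ∀ Q ∈ ρ.finProj, ρ.val Q ≤ ENNReal.ofReal t → r ≤ ‖x * (1 - Q)‖) :
    r ≤ ρ.singularValue t x :=
  le_csInf ⟨_, 0, ρ.zero_mem_finProj, by rw [ρ.val_zero]; exact zero_le, rfl⟩ (by
    rintro _ ⟨Q, hQ, hQt, rfl⟩
    exact h Q hQ hQt)

theorem IsPreservedBy.symm {β : Elt M ≃⋆ₐ[ℂ] Elt M} (hβ : ρ.IsPreservedBy β) :
    ρ.IsPreservedBy β.symm := fun x hx => by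
  have h := hβ (β.symm x) (map_nonneg β.symm hx)
  rw [StarAlgEquiv.apply_symm_apply] at h
  exact h.symm

theorem isStarProjection_map (β : Elt M ≃⋆ₐ[ℂ] Elt M) {P : Elt M} (hP : IsStarProjection P) :
    IsStarProjection (β P) where
  isIdempotentElem := by
    change β P * β P = β P
    rw [← map_mul, hP.isIdempotentElem.eq]
  isSelfAdjoint := by
    change star (β P) = β P
    rw [← map_star, hP.isSelfAdjoint.star_eq]

theorem IsPreservedBy.map_finProj {β : Elt M ≃⋆ₐ[ℂ] Elt M} (hβ : ρ.IsPreservedBy β) {P : Elt M}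
    (hP : P ∈ ρ.finProj) : β P ∈ ρ.finProj :=
  ⟨isStarProjection_map β hP.1, by rw [hβ P hP.1.nonneg]; exact hP.2⟩

theorem IsPreservedBy.map_finRank {β : Elt M ≃⋆ₐ[ℂ] Elt M} (hβ : ρ.IsPreservedBy β) {x : Elt M}
    (hx : x ∈ ρ.finRank) : β x ∈ ρ.finRank :=
  let ⟨P, hP, h⟩ := hx
  ⟨β P, hβ.map_finProj hP, by rw [← map_mul, h]⟩

end FaithfulNormalSemifiniteTrace

/-! ### Ideal property and smallness estimates for `|·|_J`. -/

namespace SymmetricOperatorNorm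

open FaithfulNormalSemifiniteTrace

variable {ρ : FaithfulNormalSemifiniteTrace M} (J : SymmetricOperatorNorm ρ)

theorem val_neg {x : Elt M} (hx : x ∈ ρ.finRank) : J.val (-x) = J.val x := by
  have := J.smul_eq (-1) x (finRank_subset_l1 hx)
  simpa using this

theorem val_zero : J.val 0 = 0 := by
  simpa using J.smul_eq 0 0 (finRank_subset_l1 (finProj_subset_finRank ρ.zero_mem_finProj))

theorem val_add_le {x y : Elt M} (hx : x ∈ ρ.finRank) (hy : y ∈ ρ.finRank) :
    J.val (x + y) ≤ J.val x + J.val y :=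
  J.add_le x (finRank_subset_l1 hx) y (finRank_subset_l1 hy)

theorem val_sub_le {x y : Elt M} (hx : x ∈ ρ.finRank) (hy : y ∈ ρ.finRank) :
    J.val (x - y) ≤ J.val x + J.val y := by
  rw [sub_eq_add_neg, ← J.val_neg hy]
  exact J.val_add_le hx (finRank_neg hy)

theorem val_nonneg {x : Elt M} (hx : x ∈ ρ.finRank) : 0 ≤ J.val x :=
  J.nonneg x (finRank_subset_l1 hx)

theorem norm_ofReal_norm_smul (a x : Elt M) : ‖((‖a‖ : ℝ) : ℂ) • x‖ = ‖a‖ * ‖x‖ := by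
  rw [norm_smul]; simp

theorem val_ofReal_norm_smul (a : Elt M) {x : Elt M} (hx : x ∈ ρ.finRank) :
    J.val (((‖a‖ : ℝ) : ℂ) • x) = ‖a‖ * J.val x := by
  rw [J.smul_eq _ x (finRank_subset_l1 hx)]; simp

theorem val_mul_left_le (a : Elt M) {x : Elt M} (hx : x ∈ ρ.finRank) :
    J.val (a * x) ≤ ‖a‖ * J.val x := by
  rw [← J.val_ofReal_norm_smul a hx]
  refine J.mono _ (finRank_subset_l1 (finRank_mul_left hx a)) _
    (finRank_subset_l1 (finRank_smul hx _)) fun t _ => le_singularValue fun Q hQ hQt => ?_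
  refine (singularValue_le hQ hQt).trans ?_
  rw [smul_mul_assoc, norm_ofReal_norm_smul, mul_assoc]
  exact norm_mul_le _ _

/-- If `R` is a right support of `Q a` with `ρ(R) ≤ ρ(Q)`, then `x a (1 - R) = x (1 - Q) a (1 - R)`.
So each competitor `Q` for `x` yields a competitor `R` for `x a`. -/
theorem val_mul_right_le (a : Elt M) {x : Elt M} (hx : x ∈ ρ.finRank) :
    J.val (x * a) ≤ ‖a‖ * J.val x := by
  rw [← J.val_ofReal_norm_smul a hx]
  refine J.mono _ (finRank_subset_l1 (finRank_mul_right hx a)) _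
    (finRank_subset_l1 (finRank_smul hx _)) fun t _ => le_singularValue fun Q hQ hQt => ?_
  obtain ⟨R, hR, hRt, h⟩ := exists_right_support hQ (x := Q * a)
    (by rw [← mul_assoc, hQ.1.isIdempotentElem.eq])
  refine (singularValue_le hR (hRt.trans hQt)).trans ?_
  have h1 : x * a * (1 - R) = x * (1 - Q) * (a * (1 - R)) := by
    have h2 : Q * (a * (1 - R)) = 0 := by rw [← mul_assoc, mul_sub, mul_one, h, sub_self]
    rw [mul_assoc x (1 - Q), sub_mul, one_mul, h2, sub_zero, mul_assoc]
  rw [h1, smul_mul_assoc, norm_ofReal_norm_smul, mul_comm ‖a‖]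
  refine (norm_mul_le _ _).trans ?_
  gcongr
  calc ‖a * (1 - R)‖ ≤ ‖a‖ * ‖1 - R‖ := norm_mul_le _ _
    _ ≤ ‖a‖ * 1 := by gcongr; exact hR.1.one_sub.norm_le
    _ = ‖a‖ := mul_one _

theorem val_map_le {β : Elt M ≃⋆ₐ[ℂ] Elt M} (hβ : ρ.IsPreservedBy β) {x : Elt M}
    (hx : x ∈ ρ.finRank) : J.val (β x) ≤ J.val x := by
  refine J.mono _ (finRank_subset_l1 (hβ.map_finRank hx)) _
    (finRank_subset_l1 hx) fun t _ => le_singularValue fun Q hQ hQt => ?_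
  refine (singularValue_le (hβ.map_finProj hQ) (by rwa [hβ Q hQ.1.nonneg])).trans_eq ?_
  have h1 : β x * (1 - β Q) = β (x * (1 - Q)) := by rw [map_mul, map_sub, map_one]
  rw [h1]
  exact NonUnitalStarAlgHom.norm_map β β.injective _

/-- On operators with a fixed finite right support, `|·|_J` is dominated by the norm. -/
theorem exists_val_le_norm : ∃ C : ℝ, 0 < C ∧ ∀ x Q : Elt M, Q ∈ ρ.finProj → x * Q = x →
    J.val x ≤ C * ((ρ.val Q).toReal + 1) * ‖x‖ := by
  obtain ⟨C, hC, h⟩ := J.upper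
  refine ⟨C, hC, fun x Q hQ hx => (h x (finRank_subset_l1 ⟨Q, hQ, hx⟩)).trans ?_⟩
  have h1 : (ρ.norm₁ x).toReal ≤ ‖x‖ * (ρ.val Q).toReal := by
    have h2 := norm₁_le (ρ := ρ) hQ.1 hx
    have h3 := ENNReal.toReal_mono (ENNReal.mul_lt_top ENNReal.ofReal_lt_top hQ.2).ne h2
    rwa [ENNReal.toReal_mul, ENNReal.toReal_ofReal (norm_nonneg _)] at h3
  calc C * ((ρ.norm₁ x).toReal + ‖x‖) ≤ C * (‖x‖ * (ρ.val Q).toReal + ‖x‖) := by gcongr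
    _ = _ := by ring

/-- The `ε`-`δ` form of the third condition on the norm: a failure at every `δ = 1 / (m + 1)` would
give a sequence contradicting it. -/
theorem exists_val_proj_le {ε : ℝ} (hε : 0 < ε) : ∃ δ : ℝ, 0 < δ ∧ ∀ P ∈ ρ.finProj,
    ρ.val P ≤ ENNReal.ofReal δ → J.val P ≤ ε := by
  by_contra! h
  choose P hP hPδ hPε using fun m : ℕ => h (1 / ((m : ℝ) + 1)) (by positivity)
  have h1 : Tendsto (fun m => ρ.val (P m)) atTop (𝓝 0) := by
    refine tendsto_of_tendsto_of_tendsto_of_le_of_le tendsto_const_nhds ?_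
      (fun _ => zero_le) hPδ
    rw [← ENNReal.ofReal_zero]
    exact ENNReal.tendsto_ofReal tendsto_one_div_add_atTop_nhds_zero_nat
  obtain ⟨m, hm⟩ := ((J.small P hP h1).eventually (gt_mem_nhds hε)).exists
  exact absurd (hPε m) (not_lt.2 hm.le)

/-- If `0 ≤ X ≤ 1` is small on the finite projection `P` in the sense of the trace, then
`X` has a small difference from its compression to `1 - P`. -/
theorem exists_val_compression_le {P : Elt M} (hP : P ∈ ρ.finProj) {ε : ℝ} (hε : 0 < ε) :
    ∃ η : ℝ, 0 < η ∧ ∀ X : Elt M, 0 ≤ X → X ≤ 1 → ρ.val (P * X * P) ≤ ENNReal.ofReal η →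
      J.val (P * X + X * P - P * X * P) ≤ ε := by
  obtain ⟨C, hC, hJ⟩ := J.exists_val_le_norm
  obtain ⟨δ, hδ, hJP⟩ := J.exists_val_proj_le (ε := ε / 6) (by positivity)
  set v := (ρ.val P).toReal + 1 with hv
  have hv0 : 0 < v := by positivity
  set r := ε / (6 * (C * v)) with hr
  have hr0 : 0 < r := by positivity
  -- Chebyshev: cutting `P X P` at height `r²` gives a projection `R` with `r² ρ(R) ≤ r² δ`, while
  -- `‖X (P - R)‖ ≤ r`. Each of `X P` and `P X` splits into two pieces of size at most `ε / 6`.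
  refine ⟨r ^ 2 * δ, by positivity, fun X hX0 hX1 hXη => ?_⟩
  have hs : 0 < r ^ 2 := by positivity
  have hY : 0 ≤ P * X * P := IsSelfAdjoint.conjugate_nonneg hX0 hP.1.isSelfAdjoint
  have hXn : ‖X‖ ≤ 1 := (CStarAlgebra.norm_le_one_iff_of_nonneg X hX0).2 hX1
  obtain ⟨R, hR, hRY, hRs, -⟩ := exists_spectral_cut hY hs
  have hRP : R ≤ P := by
    refine proj_le_of_smul_le hP.1 hR hs (c := 1) (hRY.trans ?_)
    rw [one_smul]
    have := IsSelfAdjoint.conjugate_le_conjugate hX1 hP.1.isSelfAdjoint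
    rwa [mul_one, hP.1.isIdempotentElem.eq] at this
  have hRδ : ρ.val R ≤ ENNReal.ofReal δ := by
    have h1 := (ρ.val_mono (smul_nonneg hs.le hR.nonneg) hRY).trans hXη
    rw [ρ.val_smul hs.le hR.nonneg, ENNReal.ofReal_mul hs.le] at h1
    exact (ENNReal.mul_le_mul_iff_right (ENNReal.ofReal_pos.2 hs).ne' ENNReal.ofReal_ne_top).1 h1
  have hRf : R ∈ ρ.finProj := ⟨hR, hRδ.trans_lt ENNReal.ofReal_lt_top⟩
  have hJR := hJP R hRf hRδ
  have hRP1 : R * P = R := ((hR.le_iff_mul_eq_left hP.1).1 hRP)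
  have hPR1 : P * R = R := ((hR.le_iff_mul_eq_right hP.1).1 hRP)
  have hD : IsStarProjection (P - R) := (hR.le_iff_sub hP.1).1 hRP
  have hDP : (P - R) * P = P - R := by rw [sub_mul, hP.1.isIdempotentElem.eq, hRP1]
  have hPD : P * (P - R) = P - R := by rw [mul_sub, hP.1.isIdempotentElem.eq, hPR1]
  have hDval : (P - R) ∈ ρ.finProj :=
    ⟨hD, (ρ.val_mono hD.nonneg (sub_le_self _ hR.nonneg)).trans_lt hP.2⟩
  have hXD : ‖X * (P - R)‖ ≤ r := by
    refine abs_le_of_sq_le_sq' (norm_mul_sq_le hD hX0 hX1 hs.le ?_) hr0.le |>.2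
    have : (1 - R) * (P * X * P) * (1 - R) = (P - R) * X * (P - R) := by
      have e1 : (1 - R) * P = P - R := by rw [sub_mul, one_mul, hRP1]
      have e2 : P * (1 - R) = P - R := by rw [mul_sub, mul_one, hPR1]
      calc (1 - R) * (P * X * P) * (1 - R) = ((1 - R) * P) * X * (P * (1 - R)) := by noncomm_ring
        _ = _ := by rw [e1, e2]
    rwa [← this]
  have hDX : ‖(P - R) * X‖ ≤ r := by
    have : (P - R) * X = star (X * (P - R)) := by
      rw [star_mul, hX0.isSelfAdjoint.star_eq, hD.isSelfAdjoint.star_eq]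
    rwa [this, norm_star]
  have hCr : C * v * r = ε / 6 := by rw [hr]; field_simp
  have hPm := finProj_subset_finRank hP
  have hRm := finProj_subset_finRank hRf
  have hDm := finProj_subset_finRank hDval
  have h1 : J.val (X * P) ≤ ε / 3 := by
    have e : X * P = X * (P - R) + X * R := by noncomm_ring
    have e1 : J.val (X * (P - R)) ≤ ε / 6 := by
      refine (hJ _ P hP (by rw [mul_assoc, hDP])).trans ?_
      rw [← hCr]; gcongr
    have e2 : J.val (X * R) ≤ ε / 6 :=
      (J.val_mul_left_le X hRm).trans
        ((mul_le_of_le_one_left (J.val_nonneg hRm) hXn).trans hJR)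
    rw [e]
    linarith [J.val_add_le (finRank_mul_left hDm X) (finRank_mul_left hRm X)]
  have h2 : J.val (P * X) ≤ ε / 3 := by
    have e : P * X = (P - R) * X + R * X := by noncomm_ring
    have e1 : J.val ((P - R) * X) ≤ ε / 6 := by
      obtain ⟨Q, hQ, hQP, hQX⟩ := exists_right_support hP (x := (P - R) * X)
        (by rw [← mul_assoc, hPD])
      refine (hJ _ Q hQ hQX).trans ?_
      rw [← hCr]
      have : (ρ.val Q).toReal + 1 ≤ v := by
        rw [hv]; gcongr; exact hP.2.ne
      gcongr
    have e2 : J.val (R * X) ≤ ε / 6 :=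
      (J.val_mul_right_le X hRm).trans
        ((mul_le_of_le_one_left (J.val_nonneg hRm) hXn).trans hJR)
    rw [e]
    linarith [J.val_add_le (finRank_mul_right hDm X) (finRank_mul_right hRm X)]
  have h3 : J.val (P * X * P) ≤ ε / 3 := by
    rw [mul_assoc]
    have hXP := finRank_mul_left hPm X
    exact (J.val_mul_left_le P hXP).trans
        ((mul_le_of_le_one_left (J.val_nonneg hXP) hP.1.norm_le).trans h1)
  have h4 := J.val_sub_le (finRank_add (finRank_mul_right hPm X) (finRank_mul_left hPm X))
    (finRank_mul_left hPm (P * X))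
  have h5 := J.val_add_le (finRank_mul_right hPm X) (finRank_mul_left hPm X)
  linarith

end SymmetricOperatorNorm

theorem map_shiftInv (β : Elt M ≃⋆ₐ[ℂ] Elt M) {G : Elt M} (hG : 0 ≤ G) :
    β (shiftInv G) = shiftInv (β G) := by
  have h1 : β (shiftInv G) * (1 + β G) = 1 := by
    rw [← map_one β, ← map_add, ← map_mul, shiftInv_mul_one_add hG]
  have h2 := one_add_mul_shiftInv (map_nonneg β hG)
  calc β (shiftInv G) = β (shiftInv G) * ((1 + β G) * shiftInv (β G)) := by rw [h2, mul_one]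
    _ = shiftInv (β G) := by rw [← mul_assoc, h1, one_mul]

/-! ### Negligible projections and their supremum. -/

namespace SymmetricOperatorNorm

open FaithfulNormalSemifiniteTrace

variable {ρ : FaithfulNormalSemifiniteTrace M} (J : SymmetricOperatorNorm ρ) {n : ℕ}

/-- The properties shared by the commutators `A ↦ [T_j, A]` and the differences
`A ↦ α_j(A) - A`. -/
structure IsCompatible (D : Fin n → Elt M → Elt M) : Prop where
  map_add : ∀ j x y, D j (x + y) = D j x + D j y
  mem : ∀ j, ∀ x ∈ ρ.finRank, D j x ∈ ρ.finRank
  bound : ∃ L : ℝ, 0 ≤ L ∧ ∀ j, ∀ x ∈ ρ.finRank, J.val (D j x) ≤ L * J.val x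
  resolvent : ∀ j, ∀ G ∈ ρ.finRank, 0 ≤ G → J.val (D j (1 - shiftInv G)) ≤ J.val (D j G)

/-- There are `A ∈ ℛ₁⁺` with `A P = P` for which the `|D_j(A)|_J` are arbitrarily small. -/
def IsNegligible (D : Fin n → Elt M → Elt M) (P : Elt M) : Prop :=
  ∀ ε : ℝ, 0 < ε → ∃ A ∈ ρ.finRankPosContr, A * P = P ∧ ∀ j, J.val (D j A) ≤ ε

theorem condenserFin_eq_zero_iff {D : Fin n → Elt M → Elt M} {P : Elt M} :
    J.condenserFin D P 0 = 0 ↔ J.IsNegligible D P := by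
  constructor
  · intro h ε hε
    have h1 : J.condenserFin D P 0 < ENNReal.ofReal ε := by
      rw [h]; exact ENNReal.ofReal_pos.2 hε
    simp only [condenserFin, iInf_lt_iff] at h1
    obtain ⟨A, ⟨hA, hAP, -⟩, h2⟩ := h1
    exact ⟨A, hA, hAP, fun j => (ENNReal.ofReal_le_ofReal_iff hε.le).1
      ((le_iSup (fun j => ENNReal.ofReal (J.val (D j A))) j).trans h2.le)⟩
  · intro h
    refine le_antisymm (ENNReal.le_of_forall_pos_le_add fun ε hε _ => ?_) zero_le
    obtain ⟨A, hA, hAP, hj⟩ := h ε hε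
    refine (iInf₂_le A ⟨hA, hAP, mul_zero A⟩).trans (iSup_le fun j => ?_)
    rw [zero_add]
    exact (ENNReal.ofReal_le_ofReal (hj j)).trans_eq ENNReal.ofReal_coe_nnreal

theorem condenser_eq_zero_iff {D : Fin n → Elt M → Elt M} {P : Elt M} :
    J.condenser D P 0 = 0 ↔ ∀ P' ∈ ρ.finProj, P' ≤ P → J.IsNegligible D P' := by
  simp only [condenser, ENNReal.iSup_eq_zero, ← condenserFin_eq_zero_iff]
  constructor
  · exact fun h P' hP' hle => h P' ⟨hP', hle⟩ 0 ⟨ρ.zero_mem_finProj, le_rfl⟩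
  · rintro h P' ⟨hP', hle⟩ Q' ⟨hQ', hQ0⟩
    rw [le_antisymm hQ0 hQ'.1.nonneg]
    exact h P' hP' hle

/-- The negligible projections of finite trace generate this monoid of positive operators. -/
def negligibleCone (D : Fin n → Elt M → Elt M) : AddSubmonoid (Elt M) :=
  AddSubmonoid.closure {P | P ∈ ρ.finProj ∧ J.IsNegligible D P}

theorem nonneg_of_mem_negligibleCone {D : Fin n → Elt M → Elt M} :
    ∀ K ∈ J.negligibleCone D, 0 ≤ K := fun K hK => by
  induction hK using AddSubmonoid.closure_induction with
  | mem P hP => exact hP.1.1.nonneg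
  | zero => exact le_rfl
  | add x y _ _ hx hy => exact add_nonneg hx hy

variable {J}

theorem IsCompatible.map_zero {D : Fin n → Elt M → Elt M} (hD : J.IsCompatible D) (j : Fin n) :
    D j 0 = 0 := by
  have := hD.map_add j 0 0
  rwa [add_zero, left_eq_add] at this

/-- Elements of the cone are dominated by finite rank operators almost annihilated by `D`. -/
theorem IsCompatible.exists_dominating {D : Fin n → Elt M → Elt M} (hD : J.IsCompatible D)
    {K : Elt M} (hK : K ∈ J.negligibleCone D) :
    ∀ ε : ℝ, 0 < ε → ∃ G ∈ ρ.finRank, K ≤ G ∧ ∀ j, J.val (D j G) ≤ ε := by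
  induction hK using AddSubmonoid.closure_induction with
  | mem P hP =>
    intro ε hε
    obtain ⟨A, hA, hAP, hj⟩ := hP.2 ε hε
    exact ⟨A, hA.1, proj_le_of_mul_eq hP.1.1 hA.2.1 hAP, hj⟩
  | zero =>
    intro ε hε
    refine ⟨0, finProj_subset_finRank ρ.zero_mem_finProj, le_rfl, fun j => ?_⟩
    rw [hD.map_zero, J.val_zero]
    exact hε.le
  | add x y _ _ hx hy =>
    intro ε hε
    obtain ⟨G, hG, hxG, hGj⟩ := hx (ε / 2) (by positivity)
    obtain ⟨G', hG', hyG', hGj'⟩ := hy (ε / 2) (by positivity)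
    refine ⟨G + G', finRank_add hG hG', add_le_add hxG hyG', fun j => ?_⟩
    rw [hD.map_add]
    linarith [J.val_add_le (hD.mem j G hG) (hD.mem j G' hG'), hGj j, hGj' j]

/-- Finite projections below the supremum of the negligible ones are negligible. -/
theorem IsCompatible.isNegligible {D : Fin n → Elt M → Elt M} (hD : J.IsCompatible D)
    {P : Elt M} (hP : P ∈ ρ.finProj)
    (hPE : supportProj (J.negligibleCone D : Set (Elt M)) * P = P) : J.IsNegligible D P := by
  intro ε hε
  obtain ⟨L, hL, hbound⟩ := hD.bound
  -- `L + 1` in place of `L` keeps the denominator positive. The order of choices matters: `η` fixes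
  -- `K`, and only then is `G` chosen, since its accuracy must be split among the summands of `K`.
  obtain ⟨η, hη, hcomp⟩ := J.exists_val_compression_le hP (ε := ε / (2 * (L + 1))) (by positivity)
  have hcone := J.nonneg_of_mem_negligibleCone (D := D)
  obtain ⟨K, hK, hKη⟩ := exists_val_conj_shiftInv_lt hcone hP hPE (ENNReal.ofReal_pos.2 hη)
  obtain ⟨G, hG, hKG, hGj⟩ := hD.exists_dominating hK (ε / 2) (by positivity)
  have hG0 : 0 ≤ G := (hcone K hK).trans hKG
  have hX0 : 0 ≤ shiftInv G := shiftInv_nonneg hG0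
  have hX1 : shiftInv G ≤ 1 := shiftInv_le_one hG0
  have hXη : ρ.val (P * shiftInv G * P) ≤ ENNReal.ofReal η :=
    (ρ.val_mono (IsSelfAdjoint.conjugate_nonneg hX0 hP.1.isSelfAdjoint)
      (IsSelfAdjoint.conjugate_le_conjugate (shiftInv_anti (hcone K hK) hKG)
        hP.1.isSelfAdjoint)).trans hKη.le
  have hC : 1 - shiftInv G ∈ ρ.finRank := by
    rw [← shiftInv_mul hG0]
    exact finRank_mul_left hG _
  have hCj : ∀ j, J.val (D j (1 - shiftInv G)) ≤ ε / 2 := fun j =>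
    (hD.resolvent j G hG hG0).trans (hGj j)
  have hW := hcomp _ hX0 hX1 hXη
  set X := shiftInv G
  have hPm := finProj_subset_finRank hP
  have hWm : P * X + X * P - P * X * P ∈ ρ.finRank :=
    finRank_sub (finRank_add (finRank_mul_right hPm X) (finRank_mul_left hPm X))
      (finRank_mul_left hPm _)
  have hPP := hP.1.isIdempotentElem.eq
  have hA1 : 1 - X + (P * X + X * P - P * X * P) = 1 - (1 - P) * X * (1 - P) := by noncomm_ring
  have hY0 : 0 ≤ (1 - P) * X * (1 - P) :=
    IsSelfAdjoint.conjugate_nonneg hX0 hP.1.one_sub.isSelfAdjoint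
  refine ⟨1 - X + (P * X + X * P - P * X * P), ⟨finRank_add hC hWm, ?_, ?_⟩, ?_, fun j => ?_⟩
  · rw [hA1]
    have h1 := IsSelfAdjoint.conjugate_le_conjugate hX1 hP.1.one_sub.isSelfAdjoint
    rw [mul_one, hP.1.one_sub.isIdempotentElem.eq] at h1
    exact sub_nonneg.2 (h1.trans hP.1.one_sub.le_one)
  · rw [hA1]
    exact sub_le_self _ hY0
  · rw [hA1, sub_mul, mul_assoc _ (1 - P) P, hP.1.one_sub_mul_self, mul_zero, sub_zero, one_mul]
  · rw [hD.map_add]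
    refine (J.val_add_le (hD.mem j _ hC) (hD.mem j _ hWm)).trans ?_
    have h1 : J.val (D j (P * X + X * P - P * X * P)) ≤ ε / 2 := by
      refine (hbound j _ hWm).trans ?_
      calc L * J.val (P * X + X * P - P * X * P) ≤ (L + 1) * (ε / (2 * (L + 1))) := by
            gcongr
            · exact J.val_nonneg hWm
            · linarith
        _ = ε / 2 := by field_simp
    linarith [hCj j]

/-- If `P` is not below `E`, then `P (1 - E) P ≠ 0`, and semifiniteness with a spectral cut gives a
nonzero finite `R ≤ P` with `s R ≤ P (1 - E) P`. But `R` is negligible, so `R ≤ E`, and compressing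
by `R` gives `s R ≤ 0`. -/
theorem IsCompatible.condenser_eq_zero_iff_le {D : Fin n → Elt M → Elt M}
    (hD : J.IsCompatible D) {P : Elt M} (hP : IsStarProjection P) :
    J.condenser D P 0 = 0 ↔ P ≤ supportProj (J.negligibleCone D : Set (Elt M)) := by
  have hE := isStarProjection_supportProj (J.negligibleCone D : Set (Elt M))
  have hES : ∀ K ∈ J.negligibleCone D,
      supportProj (J.negligibleCone D : Set (Elt M)) * K = K := fun K hK => supportProj_mul hK
  have hneg := fun {Q : Elt M} hQ hQE => hD.isNegligible (P := Q) hQ hQE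
  set E := supportProj (J.negligibleCone D : Set (Elt M))
  rw [condenser_eq_zero_iff]
  constructor
  · intro h
    have hPEP : 0 ≤ P * (1 - E) * P :=
      IsSelfAdjoint.conjugate_nonneg hE.one_sub.nonneg hP.isSelfAdjoint
    have hzero : P * (1 - E) * P = 0 := by
      by_contra hne
      obtain ⟨y, hy0, hyle, hyne, hyfin⟩ := ρ.semifinite _ hPEP hne
      -- Cutting below the norm of `y` excludes `R = 0`, which would give `‖y‖ ≤ ‖y‖ / 2`.
      have hs : 0 < ‖y‖ / 2 := by positivity
      obtain ⟨R, hR, hRy, -, hR0⟩ := exists_spectral_cut hy0 hs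
      have hRP : R ≤ P := by
        refine proj_le_of_smul_le hP hR hs (c := 1) ((hRy.trans hyle).trans ?_)
        rw [one_smul]
        have := IsSelfAdjoint.conjugate_le_conjugate hE.one_sub.le_one hP.isSelfAdjoint
        rwa [mul_one, hP.isIdempotentElem.eq] at this
      have hRf : R ∈ ρ.finProj := by
        refine ⟨hR, ?_⟩
        have h1 := (ρ.val_mono (smul_nonneg hs.le hR.nonneg) hRy).trans_lt hyfin
        rw [ρ.val_smul hs.le hR.nonneg] at h1
        exact ENNReal.lt_top_of_mul_ne_top_right h1.ne (ENNReal.ofReal_pos.2 hs).ne'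
      have hER : E * R = R := hES R (AddSubmonoid.subset_closure ⟨hRf, h R hRf hRP⟩)
      have h2 := IsSelfAdjoint.conjugate_le_conjugate (hRy.trans hyle) hR.isSelfAdjoint
      have h3 : R * (P * (1 - E) * P) * R = 0 := by
        rw [mul_assoc R, mul_assoc _ P R, (hR.le_iff_mul_eq_right hP).1 hRP, mul_assoc P, sub_mul,
          one_mul, hER, sub_self, mul_zero, mul_zero]
      rw [h3, mul_smul_comm, smul_mul_assoc, hR.isIdempotentElem.eq, hR.isIdempotentElem.eq] at h2
      have h4 := le_antisymm h2 (smul_nonneg hs.le hR.nonneg)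
      have h5 := hR0 ((smul_eq_zero.1 h4).resolve_left hs.ne')
      rw [← Algebra.algebraMap_eq_smul_one, ← CStarAlgebra.norm_le_iff_le_algebraMap y hs.le hy0]
        at h5
      linarith
    rw [hP.le_iff_mul_eq_right hE]
    have h1 : (1 - E) * P = 0 := mul_eq_zero_of_conj_le_zero hE.one_sub.nonneg
      (by rw [hP.isSelfAdjoint.star_eq, hzero])
    rw [sub_mul, one_mul, sub_eq_zero] at h1
    exact h1.symm
  · exact fun h P' hP' hle => hneg hP' ((hP'.1.le_iff_mul_eq_right hE).1 (hle.trans h))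

theorem IsNegligible.map {D : Fin n → Elt M → Elt M} {P : Elt M} (h : J.IsNegligible D P)
    (hD : J.IsCompatible D) {β : Elt M ≃⋆ₐ[ℂ] Elt M} (hβ : ρ.IsPreservedBy β)
    (hβD : ∀ j x, β (D j x) = D j (β x)) : J.IsNegligible D (β P) := by
  intro ε hε
  obtain ⟨A, ⟨hA, hA0, hA1⟩, hAP, hj⟩ := h ε hε
  refine ⟨β A, ⟨hβ.map_finRank hA, map_nonneg β hA0, ?_⟩, by rw [← map_mul, hAP], fun j => ?_⟩
  · have := OrderHomClass.mono β hA1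
    rwa [map_one] at this
  · rw [← hβD]
    exact (J.val_map_le hβ (hD.mem j A hA)).trans (hj j)

theorem condenser_map_eq_zero {D : Fin n → Elt M → Elt M} (hD : J.IsCompatible D)
    {β : Elt M ≃⋆ₐ[ℂ] Elt M} (hβ : ρ.IsPreservedBy β) (hβD : ∀ j x, β (D j x) = D j (β x))
    {P : Elt M} (h : J.condenser D P 0 = 0) : J.condenser D (β P) 0 = 0 := by
  rw [condenser_eq_zero_iff] at h ⊢
  intro P' hP' hle
  have h1 : β.symm P' ≤ P := by
    have := OrderHomClass.mono β.symm hle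
    rwa [StarAlgEquiv.symm_apply_apply] at this
  have h2 := (h _ (hβ.symm.map_finProj hP') h1).map hD hβ hβD
  rwa [StarAlgEquiv.apply_symm_apply] at h2

theorem IsCompatible.existsUnique {D : Fin n → Elt M → Elt M} (hD : J.IsCompatible D) :
    ∃! E : Elt M, IsStarProjection E ∧
      ∀ P : Elt M, IsStarProjection P → (J.condenser D P 0 = 0 ↔ P ≤ E) := by
  have hE := isStarProjection_supportProj (J.negligibleCone D : Set (Elt M))
  refine ⟨_, ⟨hE, fun P hP => hD.condenser_eq_zero_iff_le hP⟩, fun E' ⟨hE', h⟩ => ?_⟩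
  exact le_antisymm ((hD.condenser_eq_zero_iff_le hE').1 ((h _ hE').2 le_rfl))
    ((h _ hE).1 ((hD.condenser_eq_zero_iff_le hE).2 le_rfl))

/-- Both `β` and `β⁻¹` preserve vanishing of the modulus, so `β E ≤ E` and `β⁻¹ E ≤ E`. -/
theorem IsCompatible.map_eq {D : Fin n → Elt M → Elt M} (hD : J.IsCompatible D) {E : Elt M}
    (hE : IsStarProjection E)
    (h : ∀ P : Elt M, IsStarProjection P → (J.condenser D P 0 = 0 ↔ P ≤ E))
    {β : Elt M ≃⋆ₐ[ℂ] Elt M} (hβ : ρ.IsPreservedBy β) (hβD : ∀ j x, β (D j x) = D j (β x)) :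
    β E = E := by
  have h0 := (h E hE).2 le_rfl
  have h1 := (h _ (isStarProjection_map β hE)).1 (condenser_map_eq_zero hD hβ hβD h0)
  have hβD' : ∀ j x, β.symm (D j x) = D j (β.symm x) := fun j x => by
    apply (show Function.Injective (fun y => β y) from β.injective)
    simp only [hβD, StarAlgEquiv.apply_symm_apply]
  have h2 := (h _ (isStarProjection_map β.symm hE)).1 (condenser_map_eq_zero hD hβ.symm hβD' h0)
  have h3 := OrderHomClass.mono β h2
  rw [StarAlgEquiv.apply_symm_apply] at h3
  exact le_antisymm h1 h3

/-! ### Commutators and automorphism differences. -/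

theorem isCompatible_commutator (T : Fin n → Elt M) :
    J.IsCompatible (fun j A => T j * A - A * T j) where
  map_add j x y := by rw [mul_add, add_mul]; abel
  mem j x hx := finRank_sub (finRank_mul_left hx _) (finRank_mul_right hx _)
  bound := by
    refine ⟨∑ j, 2 * ‖T j‖, by positivity, fun j x hx => ?_⟩
    have h1 : 2 * ‖T j‖ ≤ ∑ i, 2 * ‖T i‖ :=
      Finset.single_le_sum (f := fun i => 2 * ‖T i‖) (fun i _ => by positivity) (Finset.mem_univ j)
    calc J.val (T j * x - x * T j) ≤ 2 * ‖T j‖ * J.val x := by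
          linarith [J.val_sub_le (finRank_mul_left hx (T j)) (finRank_mul_right hx (T j)),
            J.val_mul_left_le (T j) hx, J.val_mul_right_le (T j) hx]
      _ ≤ _ := mul_le_mul_of_nonneg_right h1 (J.val_nonneg hx)
  resolvent j G hG hG0 := by
    have hDG : T j * G - G * T j ∈ ρ.finRank :=
      finRank_sub (finRank_mul_left hG _) (finRank_mul_right hG _)
    -- The resolvent identity with both operators equal to `G`.
    have h1 : T j * (1 - shiftInv G) - (1 - shiftInv G) * T j
        = shiftInv G * (T j * G - G * T j) * shiftInv G := by
      rw [shiftInv_mul_sub_mul_shiftInv hG0 hG0]; noncomm_ring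
    have hn := norm_shiftInv_le_one hG0
    rw [h1]
    exact (J.val_mul_right_le _ (finRank_mul_left hDG _)).trans
      ((mul_le_of_le_one_left (J.val_nonneg (finRank_mul_left hDG _)) hn).trans
        ((J.val_mul_left_le _ hDG).trans (mul_le_of_le_one_left (J.val_nonneg hDG) hn)))

theorem isCompatible_automorphism {α : Fin n → (Elt M ≃⋆ₐ[ℂ] Elt M)}
    (hα : ∀ j, ρ.IsPreservedBy (α j)) : J.IsCompatible (fun j A => α j A - A) where
  map_add j x y := by rw [_root_.map_add]; abel
  mem j x hx := finRank_sub ((hα j).map_finRank hx) hx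
  bound := by
    refine ⟨2, by norm_num, fun j x hx => ?_⟩
    linarith [J.val_sub_le ((hα j).map_finRank hx) hx, J.val_map_le (hα j) hx]
  resolvent j G hG hG0 := by
    have hDG : α j G - G ∈ ρ.finRank := finRank_sub ((hα j).map_finRank hG) hG
    have hαG := map_nonneg (α j) hG0
    -- The resolvent identity with `T = 1`, applied to the pair `α j G` and `G`.
    have h1 : α j (1 - shiftInv G) - (1 - shiftInv G)
        = shiftInv G * (α j G - G) * shiftInv (α j G) := by
      have h2 := shiftInv_mul_sub_mul_shiftInv hαG hG0 1
      rw [one_mul, mul_one, mul_one, one_mul] at h2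
      rw [h2, map_sub, map_one, map_shiftInv _ hG0]; abel
    rw [h1]
    exact (J.val_mul_right_le _ (finRank_mul_left hDG _)).trans
      ((mul_le_of_le_one_left (J.val_nonneg (finRank_mul_left hDG _))
        (norm_shiftInv_le_one hαG)).trans ((J.val_mul_left_le _ hDG).trans
          (mul_le_of_le_one_left (J.val_nonneg hDG) (norm_shiftInv_le_one hG0))))

end SymmetricOperatorNorm

end QuasicentralModulus

end

theorem proposition6p3 {H : Type*} [NormedAddCommGroup H] [InnerProductSpace ℂ H]
    [CompleteSpace H] [TopologicalSpace.SeparableSpace H]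
    (M : VonNeumannAlgebra H)
    (ρ : QuasicentralModulus.FaithfulNormalSemifiniteTrace M)
    (J : QuasicentralModulus.SymmetricOperatorNorm ρ) (n : ℕ) :
    (∀ T : Fin n → QuasicentralModulus.Elt M,
      (∃! E : QuasicentralModulus.Elt M, J.IsSingularProjOp T E) ∧
      ∀ E : QuasicentralModulus.Elt M, J.IsSingularProjOp T E →
        ∀ β : QuasicentralModulus.Elt M ≃⋆ₐ[ℂ] QuasicentralModulus.Elt M,
          ρ.IsPreservedBy β → (∀ j, β (T j) = T j) → β E = E) ∧
    (∀ α : Fin n → (QuasicentralModulus.Elt M ≃⋆ₐ[ℂ] QuasicentralModulus.Elt M),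
      (∀ j, ρ.IsPreservedBy (α j)) →
      (∃! E : QuasicentralModulus.Elt M, J.IsSingularProjAut α E) ∧
      ∀ E : QuasicentralModulus.Elt M, J.IsSingularProjAut α E →
        ∀ β : QuasicentralModulus.Elt M ≃⋆ₐ[ℂ] QuasicentralModulus.Elt M,
          ρ.IsPreservedBy β → (∀ j x, β (α j x) = α j (β x)) → β E = E) := by
  refine ⟨fun T => ?_, fun α hα => ?_⟩
  · have hD := QuasicentralModulus.SymmetricOperatorNorm.isCompatible_commutator (J := J) T
    refine ⟨hD.existsUnique, fun E hE β hβ hβT => hD.map_eq hE.1 hE.2 hβ fun j x => ?_⟩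
    simp only [map_sub, map_mul, hβT]
  · have hD := QuasicentralModulus.SymmetricOperatorNorm.isCompatible_automorphism (J := J) hα
    refine ⟨hD.existsUnique, fun E hE β hβ hβα => hD.map_eq hE.1 hE.2 hβ fun j x => ?_⟩
    simp only [map_sub, hβα]
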